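/- **Conventions.** A continuum is a (nonempty) compact connected metric space, and an arc is a space homeomorphic to $[0,1]$. A dendroid is a continuum $X$ that is arcwise connected and hereditarily unicoherent (if $A,B\subseteq X$ are subcontinua whose union is a subcontinuum, then $A\cap B$ is connected). For points $p,q$ of a dendroid, $pq$ denotes the unique arc with endpoints $p,q$ (and $pp=\{p\}$). The order of a point $p\in X$ is the maximal number of arcs in $X$ that have $p$ as a common endpoint and are disjoint from one another beyond $p$; $p$ is an endpoint if its order is $1$, and a ramification point if its order is greater than $2$. $E(X)$ is the set of endpoints. A fan is a dendroid with exactly one ramification point, called its top and denoted $t$. A dendroid $X$ is smooth if there is a point $p\in X$ such that whenever $a_n\to a$ in $X$, the arcs $pa_n$ converge to the arc $pa$ in the Hausdorff metric. An orbit of $X$ is an orbit of the action on $X$ of the group of homeomorphisms of $X$ onto itself. Let $C$ be the standard middle-thirds Cantor set. The Cantor fan is the quotient space $F_C=(C\times[0,1])/(C\times\{1\})$; write $v$ for its top, the point to which $C\times\{1\}$ is collapsed. For $i=1,2,3,\dots$ let $$F_i=\bigcup\left\{\,vp_c \;:\; c\in C\cap\left[\tfrac{3^{i-1}-1}{3^{i-1}},\tfrac{3^i-2}{3^i}\right]\right\},\qquad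 p_c=\left(c,\,1-\tfrac1{2^{i-1}}\right),$$ where $vp_c$ is the arc in $F_C$ from $v$ to $p_c$. The shrinking Cantor fan is the subspace $F_{C_\omega}=\bigcup_{i\ge1}F_i$ of $F_C$. **Theorem 2.2.** Let $X$ be a smooth fan with top $t$ which is not locally connected, and suppose that $E(X)$ is an orbit of $X$. Then: 1. $X$ is homeomorphic to the Cantor fan $F_C$ if and only if $E(X)$ is closed in $X$; and 2. $X$ is homeomorphic to the shrinking Cantor fan $F_{C_\omega}$ if and only if $\overline{E(X)}=E(X)\cup\{t\}$. -/

import Mathlib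

open Set Filter Topology

namespace FanTheory

/-- `A` is an arc in `X` with endpoints `p` and `q`: the image of a homeomorphism from `[0,1]`
onto the subspace `A` taking `0` to `p` and `1` to `q` (so `p ≠ q`). -/
def IsArcBetween {X : Type*} [TopologicalSpace X] (A : Set X) (p q : X) : Prop :=
  ∃ h : unitInterval ≃ₜ A, (h 0 : X) = p ∧ (h 1 : X) = q

/-- `A` is the (possibly degenerate) arc `pq`: an arc with endpoints `p` and `q` if `p ≠ q`,
and the one-point set `{p}` if `p = q`. -/
def IsArcOrPoint {X : Type*} [TopologicalSpace X] (A : Set X) (p q : X) : Prop :=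
  IsArcBetween A p q ∨ (p = q ∧ A = {p})

/-- A subcontinuum of `X`: a compact connected (nonempty) subset. -/
def IsSubcontinuum {X : Type*} [TopologicalSpace X] (K : Set X) : Prop :=
  IsCompact K ∧ IsConnected K

/-- `K` is unicoherent: whenever `K` is the union of two subcontinua, their intersection is
connected. -/
def IsUnicoherent {X : Type*} [TopologicalSpace X] (K : Set X) : Prop :=
  ∀ A B : Set X, IsSubcontinuum A → IsSubcontinuum B → A ∪ B = K → IsConnected (A ∩ B)

/-- A dendroid: an arcwise connected and hereditarily unicoherent continuum, the latter being a
compact connected metric space; the metric is an ambient assumption on `X`. -/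
structure IsDendroid (X : Type*) [TopologicalSpace X] : Prop where
  compact : CompactSpace X
  connected : ConnectedSpace X
  arcwise_connected : ∀ p q : X, p ≠ q → ∃ A : Set X, IsArcBetween A p q
  hereditarily_unicoherent : ∀ K : Set X, IsSubcontinuum K → IsUnicoherent K

/-- A family of arcs having `p` as a common endpoint which are disjoint from one another
beyond `p`. -/
def IsArcFamilyAt {X : Type*} [TopologicalSpace X] (p : X) (F : Set (Set X)) : Prop :=
  (∀ A ∈ F, ∃ q : X, IsArcBetween A p q) ∧ F.Pairwise (fun A B => A ∩ B = {p})

/-- The order of `p` in the classical sense: the largest number of arcs which have `p` as a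
common endpoint and are disjoint from one another beyond `p` (all infinite values are recorded
as `⊤`). -/
noncomputable def pointOrder {X : Type*} [TopologicalSpace X] (p : X) : ℕ∞ :=
  ⨆ F ∈ {F : Set (Set X) | IsArcFamilyAt p F}, F.encard

/-- `E(X)`, the set of endpoints. -/
def endpoints (X : Type*) [TopologicalSpace X] : Set X := {p | pointOrder p = 1}

/-- `R(X)`, the set of ramification points. -/
def ramificationPoints (X : Type*) [TopologicalSpace X] : Set X := {p | 2 < pointOrder p}

/-- `X` is a fan with top `t`: a dendroid whose only ramification point is `t`. -/
structure IsFan (X : Type*) [TopologicalSpace X] (t : X) : Prop where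
  dendroid : IsDendroid X
  ramification : ramificationPoints X = {t}

/-- Smoothness of a dendroid: there is a point `p` such that whenever `a n → b`, the arcs
`p (a n)` converge to the arc `p b` in the Hausdorff metric. (In a dendroid the arc between two
points exists and is unique, so quantifying over all such arcs is no restriction.) -/
def IsSmooth (X : Type*) [MetricSpace X] : Prop :=
  ∃ p : X, ∀ (a : ℕ → X) (b : X), Tendsto a atTop (𝓝 b) →
    ∀ (A : ℕ → Set X) (B : Set X), (∀ n, IsArcOrPoint (A n) p (a n)) → IsArcOrPoint B p b →
      Tendsto (fun n => Metric.hausdorffDist (A n) B) atTop (𝓝 0)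

/-- `S` is an orbit of `X` under the action of the group of self-homeomorphisms of `X`. -/
def IsHomeoOrbit {X : Type*} [TopologicalSpace X] (S : Set X) : Prop :=
  ∃ x : X, S = {y | ∃ h : X ≃ₜ X, h x = y}

/-- The equivalence relation on `C × [0,1]` collapsing `C × {1}` to a point, where `C` is the
middle-thirds Cantor set. -/
def cantorFanSetoid : Setoid (cantorSet × unitInterval) where
  r a b := a = b ∨ (a.2 = 1 ∧ b.2 = 1)
  iseqv :=
    { refl := fun _ => Or.inl rfl
      symm := by
        rintro a b (h | ⟨h, k⟩)
        · exact Or.inl h.symm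
        · exact Or.inr ⟨k, h⟩
      trans := by
        rintro a b c (rfl | ⟨h, k⟩) (rfl | ⟨h', k'⟩)
        · exact Or.inl rfl
        · exact Or.inr ⟨h', k'⟩
        · exact Or.inr ⟨h, k⟩
        · exact Or.inr ⟨h, k'⟩ }

/-- The Cantor fan `F_C = (C × [0,1]) / (C × {1})`, with the quotient topology. -/
abbrev CantorFan : Type := Quotient cantorFanSetoid

/-- The point of the Cantor fan represented by `(c, s)`; the top is the common value at `s = 1`. -/
def CantorFan.mk (c : cantorSet) (s : unitInterval) : CantorFan :=
  Quotient.mk cantorFanSetoid (c, s)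

/-- The `i`-th piece (`i = 0, 1, 2, …`) of the shrinking Cantor fan: the union of the arcs of the
Cantor fan from the top to the points `(c, 1 - 1 / 2 ^ i)`, where `c` runs over the part of the
Cantor set in `[(3 ^ i - 1) / 3 ^ i, (3 ^ (i + 1) - 2) / 3 ^ (i + 1)]`. -/
def shrinkingPiece (i : ℕ) : Set CantorFan :=
  {x | ∃ (c : cantorSet) (s : unitInterval),
    (c : ℝ) ∈ Icc (((3 : ℝ) ^ i - 1) / 3 ^ i) (((3 : ℝ) ^ (i + 1) - 2) / 3 ^ (i + 1)) ∧
    1 - 1 / (2 : ℝ) ^ i ≤ (s : ℝ) ∧ x = CantorFan.mk c s}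

/-- The shrinking Cantor fan, as a subset of the Cantor fan; it is used with the subspace
topology. -/
def shrinkingCantorFan : Set CantorFan := ⋃ i : ℕ, shrinkingPiece i

end FanTheory

/-!
A fan is ordered by `x ≤ y` iff `x` lies on the arc `ty` from its top. Hereditary unicoherence makes
arcs unique (`IsDendroid.seg_eq`), and since only `t` ramifies, two points are comparable or lie on
arcs meeting only in `t` (`IsFan.trichotomy`); hence endpoints are exactly the maximal points
(`IsFan.mem_endpoints_iff`). A fan that is smooth at some point is smooth at its top, that is, the
order is closed (`IsFan.isClosed_segGraph_top`). A Whitney-type sum then gives a continuous function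
`f` that vanishes at `t` and increases strictly along the legs (`IsDendroid.exists_isHeight`), and a
point where `f` is maximal among the points above `x` is an endpoint above `x`, so that `X` is the
union of its legs.

Suppose that the endpoints accumulate at most at `t`, and let `K` be the closure of their set.
Running through the leg of `k` by height defines a continuous surjection `K × [0,1] → X` that
collapses `K × {1}`, and the leg of `t` when `t ∈ K`, to the point `t` and is injective otherwise
(`IsFan.exists_isFanParam`). So `X` is determined by `K` and by whether `t ∈ K`
(`IsFanParam.nonempty_homeomorph`). The Cantor fan and the shrinking Cantor fan have such
parametrizations over the Cantor set, with no degenerate leg and with a degenerate leg at `1`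
respectively, so it remains to identify `K` with the Cantor set.

* `K` is totally disconnected: by hereditary unicoherence a connected subset of `K` with two points
  would meet the arc between them in a connected set, but only finitely many points of that arc are
  in `K`.
* `K` has no isolated points: as the endpoints form an orbit, all of them would be isolated among
  the endpoints, which makes each leg without `t` open and `X` locally connected
  (`IsFan.locallyConnectedSpace`).

Brouwer's theorem (`nonempty_homeomorph_natToBool`) and the homogeneity of the Cantor space give a
homeomorphism, which takes `t` to `1` in the second case. Conversely, the endpoints of a
parametrized fan are the ends of its nondegenerate legs (`IsFanParam.endpoints_eq`), and for the two
parametrizations over the Cantor set their closure can be read off.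
-/

/-! ### Arcs, and arcs in dendroids -/

namespace FanTheory

variable {X : Type*} [TopologicalSpace X]

theorem isArcBetween_iff [T2Space X] {A : Set X} {p q : X} :
    IsArcBetween A p q ↔ ∃ γ : unitInterval → X,
      Continuous γ ∧ Function.Injective γ ∧ γ 0 = p ∧ γ 1 = q ∧ range γ = A := by
  constructor
  · rintro ⟨h, h0, h1⟩
    refine ⟨fun s => h s, by fun_prop, Subtype.val_injective.comp h.injective, h0, h1, ?_⟩
    rw [show (fun s => (h s : X)) = Subtype.val ∘ h from rfl, range_comp, h.surjective.range_eq,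
      image_univ, Subtype.range_coe]
  · rintro ⟨γ, hc, hi, rfl, rfl, rfl⟩
    exact ⟨(hc.isClosedEmbedding hi).isEmbedding.toHomeomorph, rfl, rfl⟩

theorem isArcBetween_image_Icc [T2Space X] {γ : unitInterval → X} (hc : Continuous γ)
    (hi : Function.Injective γ) {s u : unitInterval} (h : s < u) :
    IsArcBetween (γ '' Icc s u) (γ s) (γ u) := by
  have h' : (s : ℝ) < u := h
  let g := (iccHomeoI (s : ℝ) u h').symm
  let σ : unitInterval → unitInterval := fun r =>
    ⟨(g r).1, s.2.1.trans (g r).2.1, (g r).2.2.trans u.2.2⟩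
  have hσ : Continuous σ := by fun_prop
  have hσi : Function.Injective σ := fun a b hab =>
    g.injective (Subtype.ext (by simpa [σ, Subtype.ext_iff] using hab))
  refine isArcBetween_iff.2 ⟨γ ∘ σ, hc.comp hσ, hi.comp hσi, ?_, ?_, ?_⟩
  · exact congrArg γ (Subtype.ext (by simp [σ, g]))
  · exact congrArg γ (Subtype.ext (by simp [σ, g]))
  · rw [range_comp]
    congr 1
    ext r
    constructor
    · rintro ⟨r, rfl⟩
      exact (g r).2
    · intro hr
      obtain ⟨r', hr'⟩ := g.surjective ⟨r, hr⟩
      exact ⟨r', Subtype.ext (by simp [σ, hr'])⟩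

theorem IsArcBetween.symm {A : Set X} {p q : X} (h : IsArcBetween A p q) : IsArcBetween A q p := by
  obtain ⟨h, h0, h1⟩ := h
  exact ⟨unitInterval.symmHomeomorph.trans h, by simpa using h1, by simpa using h0⟩

theorem IsArcBetween.ne {A : Set X} {p q : X} (h : IsArcBetween A p q) : p ≠ q := by
  obtain ⟨h, rfl, rfl⟩ := h
  intro h'
  exact zero_ne_one (h.injective (Subtype.ext h'))

theorem IsArcBetween.left_mem {A : Set X} {p q : X} (h : IsArcBetween A p q) : p ∈ A := by
  obtain ⟨h, rfl, rfl⟩ := h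
  exact (h 0).2

theorem IsArcBetween.isSubcontinuum [T2Space X] {A : Set X} {p q : X} (h : IsArcBetween A p q) :
    IsSubcontinuum A := by
  obtain ⟨γ, hc, -, -, -, rfl⟩ := isArcBetween_iff.1 h
  exact ⟨isCompact_range hc, isConnected_range hc⟩

theorem IsArcOrPoint.left_mem {A : Set X} {p q : X} (h : IsArcOrPoint A p q) : p ∈ A := by
  rcases h with h | ⟨rfl, rfl⟩
  exacts [h.left_mem, rfl]

theorem IsArcOrPoint.right_mem {A : Set X} {p q : X} (h : IsArcOrPoint A p q) : q ∈ A := by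
  rcases h with h | ⟨rfl, rfl⟩
  exacts [h.symm.left_mem, rfl]

theorem IsArcOrPoint.isSubcontinuum [T2Space X] {A : Set X} {p q : X} (h : IsArcOrPoint A p q) :
    IsSubcontinuum A := by
  rcases h with h | ⟨rfl, rfl⟩
  exacts [h.isSubcontinuum, ⟨isCompact_singleton, isConnected_singleton⟩]

/-- A connected subset of an arc that contains two of its points contains everything between. -/
theorem image_Icc_subset_of_isPreconnected [T2Space X] {γ : unitInterval → X} (hc : Continuous γ)
    (hi : Function.Injective γ) {C : Set X} (hC : IsPreconnected C) (hsub : C ⊆ range γ)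
    {s u : unitInterval} (hs : γ s ∈ C) (hu : γ u ∈ C) : γ '' Icc s u ⊆ C := by
  have h1 : IsPreconnected (γ ⁻¹' C) := by
    rw [← (hc.isClosedEmbedding hi).isInducing.isPreconnected_image,
      image_preimage_eq_of_subset hsub]
    exact hC
  exact image_subset_iff.2 (h1.ordConnected.out hs hu)

theorem IsArcOrPoint.subset_of_isPreconnected [T2Space X] {A C : Set X} {p q : X}
    (h : IsArcOrPoint A p q) (hC : IsPreconnected (A ∩ C)) (hp : p ∈ C) (hq : q ∈ C) : A ⊆ C := by
  rcases h with h | ⟨rfl, rfl⟩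
  · obtain ⟨γ, hc, hi, rfl, rfl, rfl⟩ := isArcBetween_iff.1 h
    have := image_Icc_subset_of_isPreconnected hc hi hC inter_subset_left
      ⟨mem_range_self 0, hp⟩ ⟨mem_range_self 1, hq⟩
    rintro _ ⟨s, rfl⟩
    exact (this ⟨s, ⟨s.2.1, s.2.2⟩, rfl⟩).2
  · exact singleton_subset_iff.2 hp

/-- The intersection of all subcontinua containing `p` and `q`. In a dendroid this is the unique
arc with endpoints `p` and `q`, see `IsDendroid.isArcOrPoint_seg`. -/
def seg (p q : X) : Set X := ⋂₀ {K | IsSubcontinuum K ∧ p ∈ K ∧ q ∈ K}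

theorem left_mem_seg (p q : X) : p ∈ seg p q := fun _ hK => hK.2.1

theorem right_mem_seg (p q : X) : q ∈ seg p q := fun _ hK => hK.2.2

theorem seg_subset {p q : X} {K : Set X} (hK : IsSubcontinuum K) (hp : p ∈ K) (hq : q ∈ K) :
    seg p q ⊆ K := sInter_subset_of_mem ⟨hK, hp, hq⟩

theorem seg_comm (p q : X) : seg p q = seg q p := by
  unfold seg
  congr 1
  ext K
  simp only [mem_ofPred_eq, and_comm (a := p ∈ K)]

theorem seg_self (p : X) : seg p p = {p} :=
  (seg_subset ⟨isCompact_singleton, isConnected_singleton⟩ rfl rfl).antisymm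
    (singleton_subset_iff.2 (left_mem_seg p p))

theorem IsSubcontinuum.union {A B : Set X} (hA : IsSubcontinuum A) (hB : IsSubcontinuum B)
    (h : (A ∩ B).Nonempty) : IsSubcontinuum (A ∪ B) :=
  ⟨hA.1.union hB.1, hA.2.union h hB.2⟩

namespace IsDendroid


theorem isConnected_inter (hX : IsDendroid X)
    {A B : Set X} (hA : IsSubcontinuum A) (hB : IsSubcontinuum B)
    (h : (A ∩ B).Nonempty) : IsConnected (A ∩ B) :=
  hX.hereditarily_unicoherent _ (hA.union hB h) A B hA hB rfl

theorem isSubcontinuum_inter [T2Space X] (hX : IsDendroid X)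
    {A B : Set X} (hA : IsSubcontinuum A) (hB : IsSubcontinuum B)
    (h : (A ∩ B).Nonempty) : IsSubcontinuum (A ∩ B) :=
  ⟨hA.1.inter_right hB.1.isClosed, hX.isConnected_inter hA hB h⟩

theorem seg_eq [T2Space X] (hX : IsDendroid X)
    {A : Set X} {p q : X} (h : IsArcOrPoint A p q) : seg p q = A := by
  refine (seg_subset h.isSubcontinuum h.left_mem h.right_mem).antisymm ?_
  rintro x hx K ⟨hK, hp, hq⟩
  exact h.subset_of_isPreconnected
    (hX.isConnected_inter h.isSubcontinuum hK ⟨p, h.left_mem, hp⟩).isPreconnected hp hq hx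

theorem isArcOrPoint_seg [T2Space X] (hX : IsDendroid X)
    (p q : X) : IsArcOrPoint (seg p q) p q := by
  by_cases hpq : p = q
  · subst hpq
    exact Or.inr ⟨rfl, seg_self p⟩
  · obtain ⟨A, hA⟩ := hX.arcwise_connected p q hpq
    rw [hX.seg_eq (Or.inl hA)]
    exact Or.inl hA

theorem isArcBetween_seg [T2Space X] (hX : IsDendroid X)
    {p q : X} (h : p ≠ q) : IsArcBetween (seg p q) p q :=
  (hX.isArcOrPoint_seg p q).resolve_right fun h' => h h'.1

theorem isSubcontinuum_seg [T2Space X] (hX : IsDendroid X) (p q : X) : IsSubcontinuum (seg p q) :=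
  (hX.isArcOrPoint_seg p q).isSubcontinuum

theorem isClosed_seg [T2Space X] (hX : IsDendroid X)
    (p q : X) : IsClosed (seg p q) := (hX.isSubcontinuum_seg p q).1.isClosed

theorem seg_subset_seg [T2Space X] (hX : IsDendroid X)
    {p q x y : X} (hx : x ∈ seg p q) (hy : y ∈ seg p q) :
    seg x y ⊆ seg p q := seg_subset (hX.isSubcontinuum_seg p q) hx hy

theorem seg_subset_union [T2Space X] (hX : IsDendroid X)
    (a b c : X) : seg a c ⊆ seg a b ∪ seg b c :=
  seg_subset ((hX.isSubcontinuum_seg a b).union (hX.isSubcontinuum_seg b c)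
    ⟨b, right_mem_seg _ _, left_mem_seg _ _⟩) (Or.inl (left_mem_seg _ _))
    (Or.inr (right_mem_seg _ _))

theorem seg_image [T2Space X] (hX : IsDendroid X)
    {γ : unitInterval → X} (hc : Continuous γ) (hi : Function.Injective γ)
    {s u : unitInterval} (h : s ≤ u) : seg (γ s) (γ u) = γ '' Icc s u := by
  rcases h.eq_or_lt with rfl | h
  · simp [seg_self]
  · exact hX.seg_eq (Or.inl (isArcBetween_image_Icc hc hi h))

/-- An injective parametrization of the arc `seg p q`. -/
theorem exists_param [T2Space X] (hX : IsDendroid X)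
    {p q : X} (h : p ≠ q) : ∃ γ : unitInterval → X, Continuous γ ∧
    Function.Injective γ ∧ γ 0 = p ∧ γ 1 = q ∧ range γ = seg p q :=
  isArcBetween_iff.1 (hX.isArcBetween_seg h)

/-- If two subcontinua meet only in `e`, then `e` separates them. -/
theorem mem_seg_of_inter_eq [T2Space X] (hX : IsDendroid X)
    {A B : Set X} {a b e : X} (hA : IsSubcontinuum A)
    (hB : IsSubcontinuum B) (h : A ∩ B = {e}) (ha : a ∈ A) (hb : b ∈ B) : e ∈ seg a b := by
  have he : e ∈ A ∩ B := h ▸ rfl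
  have hsub : seg a b ⊆ A ∪ B := seg_subset (hA.union hB ⟨e, he⟩) (Or.inl ha) (Or.inr hb)
  obtain ⟨x, hx, hxAB⟩ := isPreconnected_closed_iff.1 (hX.isSubcontinuum_seg a b).2.isPreconnected
    A B hA.1.isClosed hB.1.isClosed hsub ⟨a, left_mem_seg _ _, ha⟩ ⟨b, right_mem_seg _ _, hb⟩
  rw [h] at hxAB
  exact hxAB ▸ hx

/-- A point `x` of `seg p q` cuts it into two arcs meeting only in `x`. -/
theorem seg_inter_seg [T2Space X] (hX : IsDendroid X)
    {p q x : X} (hx : x ∈ seg p q) : seg p x ∩ seg x q = {x} := by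
  by_cases hpq : p = q
  · subst hpq
    rw [seg_self] at hx
    obtain rfl : x = p := hx
    simp [seg_self]
  obtain ⟨γ, hc, hi, rfl, rfl, hr⟩ := hX.exists_param hpq
  rw [← hr] at hx
  obtain ⟨s, rfl⟩ := hx
  have h0 : 0 ≤ s := s.2.1
  have h1 : s ≤ 1 := s.2.2
  rw [hX.seg_image hc hi h0, hX.seg_image hc hi h1, ← image_inter hi,
    Icc_inter_Icc_eq_singleton h0 h1, image_singleton]

theorem seg_union_seg [T2Space X] (hX : IsDendroid X)
    {p q x : X} (hx : x ∈ seg p q) : seg p x ∪ seg x q = seg p q :=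
  (union_subset (hX.seg_subset_seg (left_mem_seg _ _) hx)
    (hX.seg_subset_seg hx (right_mem_seg _ _))).antisymm (hX.seg_subset_union _ _ _)

theorem eq_of_mem_seg_of_mem_seg [T2Space X] (hX : IsDendroid X)
    {p x y : X} (hx : x ∈ seg p y) (hy : y ∈ seg p x) : x = y := by
  have := hX.seg_inter_seg hx
  have h : y ∈ seg p x ∩ seg x y := ⟨hy, right_mem_seg _ _⟩
  rw [this] at h
  exact h.symm

theorem mem_seg_or_mem_seg [T2Space X] (hX : IsDendroid X)
    {p q x y : X} (hx : x ∈ seg p q) (hy : y ∈ seg p q) :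
    x ∈ seg p y ∨ y ∈ seg p x := by
  by_cases hpq : p = q
  · subst hpq
    rw [seg_self] at hx hy
    obtain rfl : x = p := hx
    exact Or.inl (left_mem_seg _ _)
  obtain ⟨γ, hc, hi, rfl, rfl, hr⟩ := hX.exists_param hpq
  rw [← hr] at hx hy
  obtain ⟨s, rfl⟩ := hx
  obtain ⟨u, rfl⟩ := hy
  have hs0 : 0 ≤ s := s.2.1
  have hu0 : 0 ≤ u := u.2.1
  rw [hX.seg_image hc hi hs0, hX.seg_image hc hi hu0]
  rcases le_total s u with h | h
  · exact Or.inl ⟨s, ⟨s.2.1, h⟩, rfl⟩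
  · exact Or.inr ⟨u, ⟨u.2.1, h⟩, rfl⟩

/-- On the arc `seg p q` the order away from `p` is the reverse of the order away from `q`. -/
theorem mem_seg_right [T2Space X] (hX : IsDendroid X)
    {p q x y : X} (hy : y ∈ seg p q) (hx : x ∈ seg p y) : y ∈ seg x q := by
  have hxq : x ∈ seg p q := hX.seg_subset_seg (left_mem_seg _ _) hy hx
  rw [← hX.seg_union_seg hxq] at hy
  rcases hy with hy | hy
  · rw [hX.eq_of_mem_seg_of_mem_seg hx hy]
    exact left_mem_seg _ _
  · exact hy

/-- Two arcs issuing from `p` share an initial segment and are disjoint afterwards. -/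
theorem exists_seg_inter_seg_eq [T2Space X] (hX : IsDendroid X) (p x y : X) :
    ∃ z, z ∈ seg p x ∧ z ∈ seg p y ∧ seg p x ∩ seg p y = seg p z := by
  by_cases hpx : p = x
  · subst hpx
    refine ⟨p, left_mem_seg _ _, left_mem_seg _ _, ?_⟩
    rw [seg_self, inter_eq_left, singleton_subset_iff]
    exact left_mem_seg _ _
  obtain ⟨γ, hc, hi, h0, h1, hr⟩ := hX.exists_param hpx
  have hcon := hX.isSubcontinuum_inter (hX.isSubcontinuum_seg p x) (hX.isSubcontinuum_seg p y)
    ⟨p, left_mem_seg _ _, left_mem_seg _ _⟩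
  have hcomp : IsCompact (γ ⁻¹' (seg p x ∩ seg p y)) :=
    (hcon.1.isClosed.preimage hc).isCompact
  obtain ⟨s, hs⟩ := hcomp.exists_isGreatest
    ⟨0, by rw [mem_preimage, h0]; exact ⟨left_mem_seg _ _, left_mem_seg _ _⟩⟩
  have hs1 : γ s ∈ seg p x ∩ seg p y := hs.1
  refine ⟨γ s, hs1.1, hs1.2, ?_⟩
  refine Subset.antisymm ?_ (seg_subset hcon ⟨left_mem_seg _ _, left_mem_seg _ _⟩ hs1)
  rintro w hw
  have : w ∈ range γ := hr ▸ hw.1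
  obtain ⟨u, rfl⟩ := this
  have hu : u ≤ s := hs.2 hw
  have hs0 : 0 ≤ s := s.2.1
  rw [← h0, hX.seg_image hc hi hs0]
  exact ⟨u, ⟨u.2.1, hu⟩, rfl⟩

end IsDendroid
end FanTheory

/-! ### Order of a point, legs and endpoints of a fan -/

namespace FanTheory

section Order
variable {X : Type*} [TopologicalSpace X]

theorem IsArcFamilyAt.encard_le {p : X} {F : Set (Set X)} (h : IsArcFamilyAt p F) :
    F.encard ≤ pointOrder p := le_iSup₂ (f := fun F (_ : IsArcFamilyAt p F) => F.encard) F h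

theorem IsArcBetween.ne_of_inter_eq {A B : Set X} {p q : X} (hA : IsArcBetween A p q)
    (h : A ∩ B = {p}) : A ≠ B := by
  rintro rfl
  rw [inter_self] at h
  exact hA.ne (h ▸ hA.symm.left_mem : q ∈ ({p} : Set X)).symm

theorem one_lt_pointOrder {A B : Set X} {p a b : X} (hA : IsArcBetween A p a)
    (hB : IsArcBetween B p b) (hAB : A ∩ B = {p}) : 1 < pointOrder p := by
  have hF : IsArcFamilyAt p {A, B} := by
    refine ⟨?_, ?_⟩
    · rintro _ (rfl | rfl)
      exacts [⟨a, hA⟩, ⟨b, hB⟩]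
    · rw [pairwise_pair]
      exact fun _ => ⟨hAB, inter_comm B A ▸ hAB⟩
  have := hF.encard_le
  rw [encard_pair (hA.ne_of_inter_eq hAB)] at this
  exact lt_of_lt_of_le (by norm_num) this

theorem two_lt_pointOrder {A B C : Set X} {p a b c : X} (hA : IsArcBetween A p a)
    (hB : IsArcBetween B p b) (hC : IsArcBetween C p c) (hAB : A ∩ B = {p}) (hAC : A ∩ C = {p})
    (hBC : B ∩ C = {p}) : 2 < pointOrder p := by
  have hF : IsArcFamilyAt p {A, B, C} := by
    refine ⟨?_, ?_⟩
    · rintro _ (rfl | rfl | rfl)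
      exacts [⟨a, hA⟩, ⟨b, hB⟩, ⟨c, hC⟩]
    · rintro _ (rfl | rfl | rfl) _ (rfl | rfl | rfl) h
      all_goals first | exact absurd rfl h | assumption | (rw [inter_comm]; assumption)
  have := hF.encard_le
  rw [encard_eq_three.2 ⟨A, B, C, hA.ne_of_inter_eq hAB, hA.ne_of_inter_eq hAC,
    hB.ne_of_inter_eq hBC, rfl⟩] at this
  exact lt_of_lt_of_le (by norm_num) this

end Order

namespace IsFan

variable {X : Type*} [TopologicalSpace X]

theorem two_lt_pointOrder_top {t : X} (hX : IsFan X t) : 2 < pointOrder t := by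
  have : t ∈ ramificationPoints X := hX.ramification ▸ rfl
  exact this

theorem eq_top_of_two_lt_pointOrder {t p : X} (hX : IsFan X t) (h : 2 < pointOrder p) : p = t := by
  have : p ∈ ramificationPoints X := h
  rwa [hX.ramification] at this

variable [T2Space X] {t : X}

/-- In a fan, two points are either on a common leg, or their arcs to the top meet only there. -/
theorem trichotomy (hX : IsFan X t) (x y : X) :
    x ∈ seg t y ∨ y ∈ seg t x ∨ seg t x ∩ seg t y = {t} := by
  have hD := hX.dendroid
  obtain ⟨z, hzx, hzy, hz⟩ := hD.exists_seg_inter_seg_eq t x y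
  by_cases h1 : z = x
  · exact Or.inl (h1 ▸ hzy)
  by_cases h2 : z = y
  · exact Or.inr (Or.inl (h2 ▸ hzx))
  by_cases h3 : z = t
  · rw [h3, seg_self] at hz
    exact Or.inr (Or.inr hz)
  refine absurd (hX.eq_top_of_two_lt_pointOrder ?_) h3
  refine two_lt_pointOrder (hD.isArcBetween_seg h3) (hD.isArcBetween_seg h1)
    (hD.isArcBetween_seg h2) ?_ ?_ ?_
  · rw [seg_comm z t, hD.seg_inter_seg hzx]
  · rw [seg_comm z t, hD.seg_inter_seg hzy]
  · refine Subset.antisymm ?_ (singleton_subset_iff.2 ⟨left_mem_seg _ _, left_mem_seg _ _⟩)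
    rw [← hD.seg_inter_seg hzx]
    refine subset_inter ?_ inter_subset_left
    rw [← hz]
    exact inter_subset_inter (hD.seg_subset_seg hzx (right_mem_seg _ _))
      (hD.seg_subset_seg hzy (right_mem_seg _ _))

/-- The endpoints of a fan are its maximal points in the order whose least element is the top. -/
theorem mem_endpoints_iff (hX : IsFan X t) {e : X} :
    e ∈ endpoints X ↔ e ≠ t ∧ ∀ y, e ∈ seg t y → y = e := by
  have hD := hX.dendroid
  constructor
  · intro (he : pointOrder e = 1)
    have het : e ≠ t := by
      rintro rfl
      have := hX.two_lt_pointOrder_top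
      rw [he] at this
      exact absurd this (by norm_num)
    refine ⟨het, fun y hy => ?_⟩
    by_contra hye
    have := one_lt_pointOrder (hD.isArcBetween_seg het) (hD.isArcBetween_seg (Ne.symm hye))
      (by rw [seg_comm e t, hD.seg_inter_seg hy])
    rw [he] at this
    exact lt_irrefl _ this
  · rintro ⟨het, hmax⟩
    -- every arc issuing from `e` runs along `seg e t` for a while
    have key : ∀ a, a ≠ e → ∃ y ∈ seg e a ∩ seg e t, y ≠ e := by
      intro a ha
      by_contra! h
      have h' : seg e t ∩ seg e a = {e} := by
        refine Subset.antisymm (fun y hy => h y ⟨hy.2, hy.1⟩) ?_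
        exact singleton_subset_iff.2 ⟨left_mem_seg _ _, left_mem_seg _ _⟩
      exact ha (hmax a (hD.mem_seg_of_inter_eq (hD.isSubcontinuum_seg _ _)
        (hD.isSubcontinuum_seg _ _) h' (right_mem_seg _ _) (right_mem_seg _ _)))
    refine le_antisymm (iSup₂_le fun F hF => ?_) ?_
    · rw [encard_le_one_iff]
      intro A B hA hB
      by_contra hAB
      have hinter := hF.2 hA hB hAB
      obtain ⟨a, ha⟩ := hF.1 A hA
      obtain ⟨b, hb⟩ := hF.1 B hB
      rw [← hD.seg_eq (Or.inl ha), ← hD.seg_eq (Or.inl hb)] at hinter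
      obtain ⟨y, hy, hye⟩ := key a ha.ne.symm
      obtain ⟨y', hy', hye'⟩ := key b hb.ne.symm
      rcases hD.mem_seg_or_mem_seg hy.2 hy'.2 with h | h
      · refine hye ((Set.ext_iff.1 hinter y).1 ⟨hy.1, ?_⟩)
        exact hD.seg_subset_seg (left_mem_seg _ _) hy'.1 h
      · refine hye' ((Set.ext_iff.1 hinter y').1 ⟨?_, hy'.1⟩)
        exact hD.seg_subset_seg (left_mem_seg _ _) hy.1 h
    · have hF : IsArcFamilyAt e {seg e t} :=
        ⟨by rintro _ rfl; exact ⟨t, hD.isArcBetween_seg het⟩, pairwise_singleton _ _⟩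
      simpa using hF.encard_le

end IsFan
end FanTheory

/-! ### Smoothness and height functions -/

namespace FanTheory

/-- The graph of the order of a dendroid with least element `p`: pairs `(x, y)` with `x` on the
arc `seg p y`. -/
def segGraph {X : Type*} [TopologicalSpace X] (p : X) : Set (X × X) := {w | w.1 ∈ seg p w.2}

/-- Smoothness at `p`, in the form of the closedness of the order based at `p`. -/
theorem IsSmooth.exists_isClosed_segGraph {X : Type*} [MetricSpace X] (hs : IsSmooth X)
    (hD : IsDendroid X) : ∃ p : X, IsClosed (segGraph p) := by
  have := hD.compact
  obtain ⟨p, hp⟩ := hs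
  refine ⟨p, IsSeqClosed.isClosed fun w y hw hwy => ?_⟩
  have h2 : Tendsto (fun n => (w n).2) atTop (𝓝 y.2) := (continuous_snd.tendsto y).comp hwy
  have h1 : Tendsto (fun n => (w n).1) atTop (𝓝 y.1) := (continuous_fst.tendsto y).comp hwy
  have h := hp _ _ h2 (fun n => seg p (w n).2) (seg p y.2) (fun n => hD.isArcOrPoint_seg _ _)
    (hD.isArcOrPoint_seg _ _)
  have h3 : Tendsto (fun n => Metric.infDist (w n).1 (seg p y.2)) atTop
      (𝓝 (Metric.infDist y.1 (seg p y.2))) :=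
    ((Metric.continuous_infDist_pt _).tendsto _).comp h1
  have h4 : Metric.infDist y.1 (seg p y.2) ≤ 0 :=
    le_of_tendsto_of_tendsto' h3 h fun n => Metric.infDist_le_hausdorffDist_of_mem (hw n)
      (Metric.hausdorffEDist_ne_top_of_nonempty_of_bounded ⟨p, left_mem_seg _ _⟩
        ⟨p, left_mem_seg _ _⟩ (Metric.isBounded_of_compactSpace) (Metric.isBounded_of_compactSpace))
  exact ((hD.isClosed_seg _ _).mem_iff_infDist_zero ⟨p, left_mem_seg _ _⟩).2
    (le_antisymm h4 Metric.infDist_nonneg)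

/-- The order restricted to an arc is closed. -/
theorem IsDendroid.isClosed_segGraph_inter {X : Type*} [TopologicalSpace X] [T2Space X]
    (hD : IsDendroid X) (t q : X) : IsClosed {w : X × X | w.1 ∈ seg t w.2 ∧ w.2 ∈ seg t q} := by
  by_cases htq : t = q
  · subst htq
    have : {w : X × X | w.1 ∈ seg t w.2 ∧ w.2 ∈ seg t t} = {(t, t)} := by
      ext ⟨x, y⟩
      simp only [mem_ofPred_eq, mem_singleton_iff, Prod.mk.injEq, seg_self]
      constructor
      · rintro ⟨h, rfl⟩
        rw [seg_self] at h
        exact ⟨h, rfl⟩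
      · rintro ⟨rfl, rfl⟩
        exact ⟨left_mem_seg _ _, rfl⟩
    rw [this]
    exact isClosed_singleton
  obtain ⟨γ, hc, hi, rfl, rfl, hr⟩ := hD.exists_param htq
  have : {w : X × X | w.1 ∈ seg (γ 0) w.2 ∧ w.2 ∈ seg (γ 0) (γ 1)} =
      Prod.map γ γ '' {v | v.1 ≤ v.2} := by
    ext ⟨x, y⟩
    constructor
    · rintro ⟨hx, hy⟩
      rw [← hr] at hy
      obtain ⟨u, rfl⟩ := hy
      have hu : (0 : unitInterval) ≤ u := u.2.1
      rw [hD.seg_image hc hi hu] at hx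
      obtain ⟨s, hs, hsx⟩ := hx
      exact ⟨(s, u), hs.2, Prod.ext hsx rfl⟩
    · rintro ⟨⟨s, u⟩, hsu, h⟩
      obtain ⟨rfl, rfl⟩ := Prod.ext_iff.1 h
      have hu : (0 : unitInterval) ≤ u := u.2.1
      refine ⟨?_, ?_⟩
      · change γ s ∈ seg (γ 0) (γ u)
        rw [hD.seg_image hc hi hu]
        exact ⟨s, ⟨s.2.1, hsu⟩, rfl⟩
      · rw [← hr]
        exact ⟨u, rfl⟩
  rw [this]
  exact (((isClosed_le continuous_fst continuous_snd).isCompact).image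
    (hc.prodMap hc)).isClosed

/-- A fan that is smooth at some point is smooth at its top. -/
theorem IsFan.isClosed_segGraph_top {X : Type*} [MetricSpace X] {t : X} (hX : IsFan X t)
    (hs : IsSmooth X) : IsClosed (segGraph t) := by
  have hD := hX.dendroid
  obtain ⟨p, hp⟩ := hs.exists_isClosed_segGraph hD
  by_cases hpt : p = t
  · exact hpt ▸ hp
  -- pairs below `p`, pairs whose larger element is above `p`, pairs on other legs
  have hcover : segGraph t ⊆ {w | w.1 ∈ seg t w.2 ∧ w.2 ∈ seg t p} ∪
      ({w | w.1 ∈ seg t w.2 ∧ p ∈ seg t w.2} ∪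
        {w | t ∈ seg p w.1 ∧ w.1 ∈ seg p w.2}) := by
    rintro ⟨x, y⟩ (hxy : x ∈ seg t y)
    rcases hX.trichotomy y p with h | h | h
    · exact Or.inl ⟨hxy, h⟩
    · exact Or.inr (Or.inl ⟨hxy, h⟩)
    · refine Or.inr (Or.inr ⟨?_, ?_⟩)
      · have h' : seg t p ∩ seg t x = {t} := by
          refine Subset.antisymm ?_ (singleton_subset_iff.2 ⟨left_mem_seg _ _, left_mem_seg _ _⟩)
          rw [← h, inter_comm]
          exact inter_subset_inter_left _ (hD.seg_subset_seg (left_mem_seg _ _) hxy)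
        exact hD.mem_seg_of_inter_eq (hD.isSubcontinuum_seg _ _) (hD.isSubcontinuum_seg _ _) h'
          (right_mem_seg _ _) (right_mem_seg _ _)
      · rw [inter_comm] at h
        have ht : t ∈ seg p y := hD.mem_seg_of_inter_eq (hD.isSubcontinuum_seg _ _)
          (hD.isSubcontinuum_seg _ _) h (right_mem_seg _ _) (right_mem_seg _ _)
        exact hD.seg_subset_seg ht (right_mem_seg _ _) hxy
  refine isClosed_of_closure_subset ((closure_mono hcover).trans ?_)
  rw [closure_union, closure_union]
  refine union_subset ?_ (union_subset ?_ ?_)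
  · rw [(hD.isClosed_segGraph_inter t p).closure_eq]
    exact fun w hw => hw.1
  · intro w hw
    obtain ⟨v, hv, hvw⟩ := mem_closure_iff_seq_limit.1 hw
    by_cases hy : ∃ y, ∃ᶠ n in atTop, (v n).2 ∈ seg t y
    · obtain ⟨y, hy⟩ := hy
      exact ((hD.isClosed_segGraph_inter t y).mem_of_frequently_of_tendsto
        (hy.mono fun n hn => ⟨(hv n).1, hn⟩) hvw).1
    simp only [not_exists, not_frequently] at hy
    -- otherwise `(v n).2` moves away along the leg through `p`, and smoothness at `p` puts all of
    -- these points on `seg p w.2`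
    have hm : ∀ m, (v m).2 ∈ seg p w.2 := by
      intro m
      have h2 : Tendsto (fun n => ((v m).2, (v n).2)) atTop (𝓝 ((v m).2, w.2)) :=
        tendsto_const_nhds.prodMk_nhds ((continuous_snd.tendsto w).comp hvw)
      refine hp.mem_of_tendsto h2 ((hy (v m).2).mono fun n hn => ?_)
      rcases hX.trichotomy (v m).2 (v n).2 with h | h | h
      · exact hD.mem_seg_right h (hv m).2
      · exact absurd h hn
      · exact absurd ((Set.ext_iff.1 h p).1 ⟨(hv m).2, (hv n).2⟩) hpt
    obtain ⟨m, hm1, hm2⟩ := ((hy w.2).and (hy p)).exists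
    rcases hD.seg_subset_union p t w.2 (hm m) with h | h
    · rw [seg_comm] at h
      exact absurd h hm2
    · exact absurd h hm1
  · have hcl : IsClosed {w : X × X | t ∈ seg p w.1 ∧ w.1 ∈ seg p w.2} :=
      (hp.preimage (f := fun w : X × X => (t, w.1)) (by fun_prop)).inter hp
    rw [hcl.closure_eq]
    rintro ⟨x, y⟩ ⟨h1, h2⟩
    change t ∈ seg p x at h1
    change x ∈ seg p y at h2
    change x ∈ seg t y
    rcases hD.seg_subset_union p t y h2 with h | h
    · rw [hD.eq_of_mem_seg_of_mem_seg h h1]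
      exact left_mem_seg _ _
    · exact h

section Semicontinuity

variable {X : Type*} [TopologicalSpace X] [T2Space X] {t : X}

theorem IsDendroid.eventually_seg_subset (hD : IsDendroid X) (hR : IsClosed (segGraph t)) {y : X}
    {O : Set X} (hO : IsOpen O) (h : seg t y ⊆ O) : ∀ᶠ y' in 𝓝 y, seg t y' ⊆ O := by
  have := hD.compact
  have hcl : IsClosed (Prod.snd '' (segGraph t ∩ Prod.fst ⁻¹' Oᶜ)) :=
    ((hR.inter (hO.isClosed_compl.preimage continuous_fst)).isCompact.image
      continuous_snd).isClosed
  have hy : y ∉ Prod.snd '' (segGraph t ∩ Prod.fst ⁻¹' Oᶜ) := by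
    rintro ⟨⟨x, _⟩, ⟨hx, hxO⟩, rfl⟩
    exact hxO (h hx)
  filter_upwards [hcl.isOpen_compl.mem_nhds hy] with y' hy' x hx
  by_contra hxO
  exact hy' ⟨(x, y'), ⟨hx, hxO⟩, rfl⟩

/-- The lower half of continuity follows from the upper half because the arcs are connected:
an arc avoiding a small neighbourhood of an interior point of `seg t y` would be cut in two. -/
theorem IsDendroid.eventually_seg_inter_nonempty (hD : IsDendroid X) (hR : IsClosed (segGraph t))
    {y : X} {O : Set X} (hO : IsOpen O) (h : (seg t y ∩ O).Nonempty) :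
    ∀ᶠ y' in 𝓝 y, (seg t y' ∩ O).Nonempty := by
  by_cases htO : t ∈ O
  · exact Eventually.of_forall fun y' => ⟨t, left_mem_seg _ _, htO⟩
  by_cases hyO : y ∈ O
  · filter_upwards [hO.mem_nhds hyO] with y' hy'
    exact ⟨y', right_mem_seg _ _, hy'⟩
  obtain ⟨x, hx, hxO⟩ := h
  have hdisj : Disjoint (seg t x \ O) (seg x y \ O) := by
    rw [Set.disjoint_left]
    rintro z ⟨hz, hzO⟩ ⟨hz', -⟩
    have hzx : z ∈ seg t x ∩ seg x y := ⟨hz, hz'⟩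
    rw [hD.seg_inter_seg hx] at hzx
    exact hzO (hzx ▸ hxO)
  obtain ⟨O1, O2, hO1, hO2, hA, hB, h12⟩ := SeparatedNhds.of_isCompact_isCompact
    ((hD.isSubcontinuum_seg t x).1.diff hO) ((hD.isSubcontinuum_seg x y).1.diff hO) hdisj
  have hsub : seg t y ⊆ O1 ∪ O2 ∪ O := by
    rw [← hD.seg_union_seg hx]
    rintro z hz
    by_cases hzO : z ∈ O
    · exact Or.inr hzO
    · rcases hz with hz | hz
      · exact Or.inl (Or.inl (hA ⟨hz, hzO⟩))
      · exact Or.inl (Or.inr (hB ⟨hz, hzO⟩))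
  filter_upwards [hD.eventually_seg_subset hR ((hO1.union hO2).union hO) hsub,
    hO2.mem_nhds (hB ⟨right_mem_seg _ _, hyO⟩)] with y' hy' hy2
  by_contra hne
  have hsub' : seg t y' ⊆ O1 ∪ O2 := fun z hz =>
    (hy' hz).resolve_right fun hzO => hne ⟨z, hz, hzO⟩
  obtain ⟨z, -, hz⟩ := (hD.isSubcontinuum_seg t y').2.isPreconnected O1 O2 hO1 hO2 hsub'
    ⟨t, left_mem_seg _ _, hA ⟨left_mem_seg _ _, htO⟩⟩ ⟨y', right_mem_seg _ _, hy2⟩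
  exact Set.disjoint_left.1 h12 hz.1 hz.2

end Semicontinuity

/-- A height function on a dendroid based at `t`: continuous, zero at `t`, and strictly increasing
along the arcs issuing from `t`. -/
structure IsHeight {X : Type*} [TopologicalSpace X] (t : X) (f : X → ℝ) : Prop where
  continuous : Continuous f
  map_top : f t = 0
  strictMono : ∀ x y, x ∈ seg t y → x ≠ y → f x < f y

section Height

variable {X : Type*} [MetricSpace X] {t : X}

theorem IsDendroid.continuous_infDist_seg (hD : IsDendroid X) (hR : IsClosed (segGraph t))
    (q : X) : Continuous fun y => Metric.infDist q (seg t y) := by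
  refine continuous_iff_continuousAt.2 fun y => tendsto_order.2 ⟨fun a ha => ?_, fun a ha => ?_⟩
  · have hsub : seg t y ⊆ {z | a < dist q z} := fun z hz =>
      ha.trans_le (Metric.infDist_le_dist_of_mem hz)
    filter_upwards [hD.eventually_seg_subset hR
      (isOpen_lt continuous_const (continuous_const.dist continuous_id)) hsub] with y' hy'
    obtain ⟨z, hz, hzq⟩ := (hD.isSubcontinuum_seg t y').1.exists_infDist_eq_dist
      ⟨t, left_mem_seg _ _⟩ q
    rw [hzq]
    exact hy' hz
  · obtain ⟨z, hz, hzq⟩ := (Metric.infDist_lt_iff ⟨t, left_mem_seg _ _⟩).1 ha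
    filter_upwards [hD.eventually_seg_inter_nonempty hR
      (isOpen_lt (continuous_const.dist continuous_id) continuous_const)
      (⟨z, hz, hzq⟩ : (seg t y ∩ {z | dist q z < a}).Nonempty)] with y' hy'
    obtain ⟨z, hz, hzq⟩ := hy'
    exact (Metric.infDist_le_dist_of_mem hz).trans_lt hzq

/-- A smooth dendroid has a height function. As with Whitney maps, it is a weighted sum over a
dense sequence `q` of the amounts by which `seg t y` is closer to `q k` than `t` is. -/
theorem IsDendroid.exists_isHeight (hD : IsDendroid X) (hR : IsClosed (segGraph t)) :
    ∃ f : X → ℝ, IsHeight t f := by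
  have := hD.compact
  have : Nonempty X := ⟨t⟩
  let q := TopologicalSpace.denseSeq X
  let g : ℕ → X → ℝ := fun k y => (1 / 2) ^ k * (dist (q k) t - Metric.infDist (q k) (seg t y))
  have hle : ∀ k y, Metric.infDist (q k) (seg t y) ≤ dist (q k) t := fun k y =>
    Metric.infDist_le_dist_of_mem (left_mem_seg _ _)
  have hg0 : ∀ k y, 0 ≤ g k y := fun k y =>
    mul_nonneg (by positivity) (sub_nonneg.2 (hle k y))
  have hgb : ∀ k y, g k y ≤ (1 / 2) ^ k * Metric.diam (univ : Set X) := by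
    intro k y
    refine mul_le_mul_of_nonneg_left ?_ (by positivity)
    have h1 : dist (q k) t ≤ Metric.diam (univ : Set X) :=
      Metric.dist_le_diam_of_mem Metric.isBounded_of_compactSpace (mem_univ _) (mem_univ _)
    have h2 : 0 ≤ Metric.infDist (q k) (seg t y) := Metric.infDist_nonneg
    linarith
  have hsum : Summable fun k : ℕ => (1 / 2 : ℝ) ^ k * Metric.diam (univ : Set X) :=
    summable_geometric_two.mul_right _
  have hsg : ∀ y, Summable fun k => g k y := fun y =>
    Summable.of_nonneg_of_le (fun k => hg0 k y) (fun k => hgb k y) hsum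
  refine ⟨fun y => ∑' k, g k y, ?_, ?_, ?_⟩
  · refine continuous_tsum (fun k => ?_) hsum fun k y => ?_
    · exact continuous_const.mul (continuous_const.sub (hD.continuous_infDist_seg hR _))
    · rw [Real.norm_of_nonneg (hg0 k y)]
      exact hgb k y
  · simp [g, seg_self]
  · intro x y hxy hne
    have hsub : seg t x ⊆ seg t y := hD.seg_subset_seg (left_mem_seg _ _) hxy
    have hy : y ∉ seg t x := fun h => hne (hD.eq_of_mem_seg_of_mem_seg hxy h)
    have hpos : 0 < Metric.infDist y (seg t x) :=
      ((hD.isClosed_seg t x).notMem_iff_infDist_pos ⟨t, left_mem_seg _ _⟩).1 hy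
    obtain ⟨k, hk⟩ := (TopologicalSpace.denseRange_denseSeq X).exists_dist_lt y (half_pos hpos)
    refine Summable.tsum_lt_tsum (i := k) (fun k => ?_) ?_ (hsg x) (hsg y)
    · refine mul_le_mul_of_nonneg_left (sub_le_sub_left ?_ _) (by positivity)
      exact Metric.infDist_le_infDist_of_subset hsub ⟨t, left_mem_seg _ _⟩
    · refine mul_lt_mul_of_pos_left (sub_lt_sub_left ?_ _) (by positivity)
      have h1 : Metric.infDist (q k) (seg t y) ≤ dist (q k) y :=
        Metric.infDist_le_dist_of_mem (right_mem_seg _ _)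
      have h2 : Metric.infDist y (seg t x) ≤ Metric.infDist (q k) (seg t x) + dist y (q k) :=
        Metric.infDist_le_infDist_add_dist
      have h3 : dist y (q k) < Metric.infDist y (seg t x) / 2 := hk
      rw [dist_comm] at h1
      linarith

end Height

namespace IsHeight

variable {X : Type*} [TopologicalSpace X] {t : X} {f : X → ℝ}

theorem monotone (hf : IsHeight t f) {x y : X} (h : x ∈ seg t y) : f x ≤ f y := by
  by_cases hxy : x = y
  · rw [hxy]
  · exact (hf.strictMono x y h hxy).le

theorem pos (hf : IsHeight t f) {x : X} (h : x ≠ t) : 0 < f x := by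
  have := hf.strictMono t x (left_mem_seg _ _) h.symm
  rwa [hf.map_top] at this

theorem nonneg (hf : IsHeight t f) (x : X) : 0 ≤ f x := by
  have := hf.monotone (left_mem_seg t x)
  rwa [hf.map_top] at this

variable [T2Space X]

theorem injOn (hf : IsHeight t f) (hD : IsDendroid X) {x y e : X} (hx : x ∈ seg t e)
    (hy : y ∈ seg t e) (h : f x = f y) : x = y := by
  by_contra hxy
  rcases hD.mem_seg_or_mem_seg hx hy with h' | h'
  · exact (hf.strictMono x y h' hxy).ne h
  · exact (hf.strictMono y x h' (Ne.symm hxy)).ne h.symm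

theorem exists_mem_seg_eq (hf : IsHeight t f) (hD : IsDendroid X) {e : X} {r : ℝ} (h0 : 0 ≤ r)
    (h1 : r ≤ f e) : ∃ x ∈ seg t e, f x = r := by
  have := (hD.isSubcontinuum_seg t e).2.isPreconnected.intermediate_value (left_mem_seg _ _)
    (right_mem_seg _ _) hf.continuous.continuousOn
  rw [hf.map_top] at this
  exact this ⟨h0, h1⟩

/-- Every point of a smooth fan lies on the arc from the top to some endpoint. -/
theorem exists_endpoint (hf : IsHeight t f) (hX : IsFan X t) (hR : IsClosed (segGraph t)) {x : X}
    (hx : x ≠ t) : ∃ e ∈ endpoints X, x ∈ seg t e := by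
  have := hX.dendroid.compact
  have hcl : IsClosed {y | x ∈ seg t y} :=
    hR.preimage (f := fun y : X => (x, y)) (by fun_prop)
  obtain ⟨e, he, hmax⟩ := hcl.isCompact.exists_isMaxOn ⟨x, right_mem_seg _ _⟩
    hf.continuous.continuousOn
  have he' : x ∈ seg t e := he
  refine ⟨e, hX.mem_endpoints_iff.2 ⟨?_, fun y hy => ?_⟩, he⟩
  · rintro rfl
    rw [seg_self] at he'
    exact hx he'
  · by_contra hne
    have hxy : x ∈ seg t y := hX.dendroid.seg_subset_seg (left_mem_seg _ _) hy he'
    exact (hf.strictMono e y hy (Ne.symm hne)).not_ge (hmax hxy)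

end IsHeight
end FanTheory

/-! ### Legs of a smooth fan: parametrization and local connectedness -/

namespace FanTheory

/-- `Φ` presents `X` as the quotient of `K × [0,1]` that collapses `K × {1} ∪ Z × [0,1]` to the
point `v`, up to the topology: it is a continuous surjection with the fibres of that quotient
map. -/
structure IsFanParam {K X : Type*} [TopologicalSpace K] [TopologicalSpace X] (Z : Set K) (v : X)
    (Φ : K × unitInterval → X) : Prop where
  continuous : Continuous Φ
  surjective : Function.Surjective Φ
  eq_top_iff : ∀ k u, Φ (k, u) = v ↔ u = 1 ∨ k ∈ Z
  eq_of_eq : ∀ a b, Φ a = Φ b → Φ a ≠ v → a = b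

section Legs

variable {X : Type*} [TopologicalSpace X] [T2Space X] {t : X}

theorem IsFan.eq_of_mem_seg (hX : IsFan X t) {e e' x : X} (he : e ∈ endpoints X)
    (he' : e' ∈ endpoints X) (hx : x ≠ t) (h : x ∈ seg t e) (h' : x ∈ seg t e') : e = e' := by
  rcases hX.trichotomy e e' with h1 | h1 | h1
  · exact ((hX.mem_endpoints_iff.1 he).2 e' h1).symm
  · exact (hX.mem_endpoints_iff.1 he').2 e h1
  · exact absurd ((Set.ext_iff.1 h1 x).1 ⟨h, h'⟩) hx

/-- If the endpoints accumulate at most at the top, their closure is totally disconnected: a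
connected subset with two points would, by hereditary unicoherence, meet the arc between these
points in a connected set, but that arc contains at most three points of the closure. -/
theorem IsFan.isTotallyDisconnected_closure_endpoints (hX : IsFan X t)
    (hcl : closure (endpoints X) ⊆ endpoints X ∪ {t}) :
    IsTotallyDisconnected (closure (endpoints X)) := by
  have hD := hX.dendroid
  have := hD.compact
  intro C hC hCc x hx y hy
  by_contra hxy
  have hDK : closure C ⊆ closure (endpoints X) := closure_minimal hC isClosed_closure
  have hDs : IsSubcontinuum (closure C) :=
    ⟨isClosed_closure.isCompact, ⟨x, subset_closure hx⟩, hCc.closure⟩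
  have hcon := hD.isConnected_inter hDs (hD.isSubcontinuum_seg x y)
    ⟨x, subset_closure hx, left_mem_seg _ _⟩
  have key : ∀ k ∈ closure (endpoints X), ∀ z ∈ closure (endpoints X), k ∈ seg t z →
      k = t ∨ k = z := by
    intro k hk z _ hkz
    rcases hcl hk with hk | hk
    · exact Or.inr ((hX.mem_endpoints_iff.1 hk).2 z hkz).symm
    · exact Or.inl hk
  have hfin : (closure C ∩ seg x y).Finite := by
    refine (toFinite {t, x, y}).subset ?_
    rintro k ⟨hk, hkxy⟩
    rcases hD.seg_subset_union x t y hkxy with h | h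
    · rw [seg_comm] at h
      rcases key k (hDK hk) x (hC hx) h with h | h <;> simp [h]
    · rcases key k (hDK hk) y (hC hy) h with h | h <;> simp [h]
  exact hcon.isPreconnected.infinite_of_nontrivial
    ⟨x, ⟨subset_closure hx, left_mem_seg _ _⟩, y, ⟨subset_closure hy, right_mem_seg _ _⟩, hxy⟩ hfin

variable {f : X → ℝ}

/-- A fan whose endpoints accumulate at most at the top is determined by the closure of its set of
endpoints. The parametrization runs through the leg of `k` by height, from `k` to the top. -/
theorem IsFan.exists_isFanParam (hX : IsFan X t) (hR : IsClosed (segGraph t))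
    (hf : IsHeight t f) (hne : (endpoints X).Nonempty)
    (hcl : closure (endpoints X) ⊆ endpoints X ∪ {t}) :
    ∃ Φ : closure (endpoints X) × unitInterval → X,
      IsFanParam {k : closure (endpoints X) | (k : X) = t} t Φ := by
  have hD := hX.dendroid
  have := hD.compact
  have hex : ∀ a : closure (endpoints X) × unitInterval,
      ∃ x ∈ seg t (a.1 : X), f x = (1 - (a.2 : ℝ)) * f a.1 := by
    intro a
    have h0 := a.2.2.1
    have h1 := a.2.2.2
    have h2 := hf.nonneg (a.1 : X)
    exact hf.exists_mem_seg_eq hD (mul_nonneg (by linarith) h2)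
      (mul_le_of_le_one_left h2 (by linarith))
  choose Φ hΦ hfΦ using hex
  have huniq : ∀ a x, x ∈ seg t (a.1 : X) → f x = (1 - (a.2 : ℝ)) * f a.1 → Φ a = x :=
    fun a x hx hfx => hf.injOn hD (hΦ a) hx ((hfΦ a).trans hfx.symm)
  have htop : ∀ k u, Φ (k, u) = t ↔ u = 1 ∨ (k : X) = t := by
    intro k u
    have hzero : Φ (k, u) = t ↔ f (Φ (k, u)) = 0 := by
      constructor
      · intro h
        rw [h, hf.map_top]
      · intro h
        by_contra hne
        exact (hf.pos hne).ne' h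
    rw [hzero, hfΦ, mul_eq_zero]
    refine or_congr ?_ ?_
    · rw [sub_eq_zero, eq_comm, ← Set.Icc.coe_one, Subtype.ext_iff]
    · constructor
      · intro h
        by_contra hne
        exact (hf.pos hne).ne' h
      · intro h
        rw [h, hf.map_top]
  refine ⟨Φ, ?_, ?_, htop, ?_⟩
  · refine continuous_iff_isClosed.2 fun C hC => ?_
    have : Φ ⁻¹' C = Prod.fst '' {w : (closure (endpoints X) × unitInterval) × X |
        ((w.2, (w.1.1 : X)) ∈ segGraph t ∧ f w.2 = (1 - (w.1.2 : ℝ)) * f w.1.1) ∧ w.2 ∈ C} := by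
      ext a
      constructor
      · intro ha
        exact ⟨(a, Φ a), ⟨⟨hΦ a, hfΦ a⟩, ha⟩, rfl⟩
      · rintro ⟨⟨a, x⟩, ⟨⟨h1, h2⟩, h3⟩, rfl⟩
        change Φ a ∈ C
        rwa [huniq a x h1 h2]
    rw [this]
    have hfc := hf.continuous
    refine isClosedMap_fst_of_compactSpace _ (IsClosed.inter (IsClosed.inter ?_ ?_) ?_)
    · exact hR.preimage (f := fun w : (closure (endpoints X) × unitInterval) × X =>
        (w.2, (w.1.1 : X))) (by fun_prop)
    · exact isClosed_eq (by fun_prop) (by fun_prop)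
    · exact hC.preimage continuous_snd
  · intro x
    by_cases hx : x = t
    · obtain ⟨e, he⟩ := hne
      exact ⟨(⟨e, subset_closure he⟩, 1), ((htop _ 1).2 (Or.inl rfl)).trans hx.symm⟩
    · obtain ⟨e, he, hxe⟩ := hf.exists_endpoint hX hR hx
      have hpos : 0 < f e := (hf.pos hx).trans_le (hf.monotone hxe)
      have h1 : f x / f e ≤ 1 := (div_le_one hpos).2 (hf.monotone hxe)
      have h0 : 0 ≤ f x / f e := div_nonneg (hf.nonneg x) hpos.le
      refine ⟨(⟨e, subset_closure he⟩, ⟨1 - f x / f e, by linarith, by linarith⟩), ?_⟩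
      refine huniq _ _ hxe ?_
      simp only [sub_sub_cancel]
      rw [div_mul_cancel₀ _ hpos.ne']
  · rintro ⟨k, u⟩ ⟨k', u'⟩ h hne
    have hne' : Φ (k', u') ≠ t := h ▸ hne
    have hk : (k : X) ≠ t := fun hk => hne ((htop k u).2 (Or.inr hk))
    have hk' : (k' : X) ≠ t := fun hk => hne' ((htop k' u').2 (Or.inr hk))
    have hkk : k = k' := Subtype.ext (hX.eq_of_mem_seg ((hcl k.2).resolve_right hk)
      ((hcl k'.2).resolve_right hk') hne (hΦ (k, u)) (h ▸ hΦ (k', u')))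
    subst hkk
    have h1 := hfΦ (k, u)
    rw [h, hfΦ (k, u')] at h1
    have h2 := mul_right_cancel₀ (hf.pos hk).ne' h1
    simp only [sub_right_inj] at h2
    rw [Subtype.ext h2]

theorem IsHeight.exists_connected_nhds_top (hf : IsHeight t f) (hD : IsDendroid X) {U : Set X}
    (hU : U ∈ 𝓝 t) : ∃ V ∈ 𝓝 t, IsPreconnected V ∧ V ⊆ U := by
  have := hD.compact
  obtain ⟨ε, hε, hsub⟩ : ∃ ε > 0, {x | f x < ε} ⊆ U := by
    by_cases hne : (interior U)ᶜ.Nonempty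
    · obtain ⟨m, hm, hmin⟩ := isOpen_interior.isClosed_compl.isCompact.exists_isMinOn hne
        hf.continuous.continuousOn
      refine ⟨f m, hf.pos ?_, fun x (hx : f x < f m) => ?_⟩
      · rintro rfl
        exact hm (mem_interior_iff_mem_nhds.2 hU)
      · by_contra hxU
        exact hx.not_ge (hmin fun h => hxU (interior_subset h))
    · refine ⟨1, one_pos, fun x _ => ?_⟩
      by_contra hxU
      exact hne ⟨x, fun h => hxU (interior_subset h)⟩
  refine ⟨{x | f x < ε}, ?_, ?_, hsub⟩
  · exact (isOpen_lt hf.continuous continuous_const).mem_nhds (by simpa [hf.map_top] using hε)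
  · refine isPreconnected_of_forall t fun y hy => ⟨seg t y, fun z hz => ?_, left_mem_seg _ _,
      right_mem_seg _ _, (hD.isSubcontinuum_seg t y).2.isPreconnected⟩
    exact (hf.monotone hz).trans_lt hy

theorem unitInterval_locallyConnectedSpace : LocallyConnectedSpace unitInterval :=
  (isQuotientMap_projIcc (h := zero_le_one' ℝ)).isCoinducing.locallyConnectedSpace

/-- If the endpoint `e` is isolated among the endpoints, its leg without the top is open. -/
theorem IsFan.isOpen_seg_diff_top (hX : IsFan X t) (hR : IsClosed (segGraph t))
    (hf : IsHeight t f) (hcl : closure (endpoints X) ⊆ endpoints X ∪ {t}) {e : X}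
    (he : e ∈ endpoints X) {U : Set X} (hU : IsOpen U) (hUe : U ∩ endpoints X = {e}) :
    IsOpen (seg t e \ {t}) := by
  have hD := hX.dendroid
  have := hD.compact
  have heU : e ∈ U := (hUe.symm ▸ rfl : e ∈ U ∩ endpoints X).1
  have hclosed : IsClosed (Prod.fst '' (segGraph t ∩
      Prod.snd ⁻¹' (closure (endpoints X) ∩ Uᶜ))) :=
    isClosedMap_fst_of_compactSpace _
      (hR.inter ((isClosed_closure.inter hU.isClosed_compl).preimage continuous_snd))
  have : seg t e \ {t} = (Prod.fst '' (segGraph t ∩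
      Prod.snd ⁻¹' (closure (endpoints X) ∩ Uᶜ)))ᶜ ∩ {t}ᶜ := by
    ext y
    constructor
    · rintro ⟨hy, hyt⟩
      refine ⟨?_, hyt⟩
      rintro ⟨⟨y, k⟩, ⟨hyk, hk, hkU⟩, rfl⟩
      change y ∈ seg t k at hyk
      rcases hcl hk with hkE | hkt
      · exact hkU (hX.eq_of_mem_seg he hkE hyt hy hyk ▸ heU)
      · obtain rfl : k = t := hkt
        rw [seg_self] at hyk
        exact hyt hyk
    · rintro ⟨hy, hyt⟩
      refine ⟨?_, hyt⟩
      obtain ⟨e', he', hye'⟩ := hf.exists_endpoint hX hR hyt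
      by_cases hU' : e' ∈ U
      · obtain rfl : e' = e := (Set.ext_iff.1 hUe e').1 ⟨hU', he'⟩
        exact hye'
      · exact absurd ⟨(y, e'), ⟨hye', subset_closure he', hU'⟩, rfl⟩ hy
  rw [this]
  exact hclosed.isOpen_compl.inter isOpen_compl_singleton

/-- A smooth fan whose endpoints are isolated from one another and accumulate at most at the top is
locally connected. -/
theorem IsFan.locallyConnectedSpace (hX : IsFan X t) (hR : IsClosed (segGraph t))
    (hf : IsHeight t f) (hcl : closure (endpoints X) ⊆ endpoints X ∪ {t})
    (hiso : ∀ e ∈ endpoints X, ∃ U, IsOpen U ∧ U ∩ endpoints X = {e}) :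
    LocallyConnectedSpace X := by
  have hD := hX.dendroid
  refine locallyConnectedSpace_iff_connected_subsets.2 fun x U hU => ?_
  by_cases hx : x = t
  · subst hx
    exact hf.exists_connected_nhds_top hD hU
  obtain ⟨e, he, hxe⟩ := hf.exists_endpoint hX hR hx
  obtain ⟨O, hO, hOe⟩ := hiso e he
  have hopen := hX.isOpen_seg_diff_top hR hf hcl he hO hOe
  obtain ⟨γ, hc, hi, -, -, hr⟩ := hD.exists_param (hX.mem_endpoints_iff.1 he).1.symm
  have hnhds : range γ ∈ 𝓝 x := by
    rw [hr]
    exact mem_of_superset (hopen.mem_nhds ⟨hxe, hx⟩) sdiff_subset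
  obtain ⟨s, rfl⟩ : x ∈ range γ := hr ▸ hxe
  obtain ⟨W, hW, hWc, hWU⟩ := locallyConnectedSpace_iff_connected_subsets.1
    unitInterval_locallyConnectedSpace s (γ ⁻¹' U) (hc.continuousAt hU)
  refine ⟨γ '' W, ?_, hWc.image _ hc.continuousOn, image_subset_iff.2 hWU⟩
  have hmap := (hc.isClosedEmbedding hi).isEmbedding.map_nhds_eq s
  rw [nhdsWithin_eq_nhds.2 hnhds] at hmap
  rw [← hmap]
  exact image_mem_map hW

/-- One isolated point would be an endpoint, and its translates under homeomorphisms would isolate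
all other endpoints. -/
theorem IsFan.not_isOpen_singleton (hX : IsFan X t) (hR : IsClosed (segGraph t))
    (hf : IsHeight t f) (hcl : closure (endpoints X) ⊆ endpoints X ∪ {t})
    (hnlc : ¬ LocallyConnectedSpace X) (horbit : IsHomeoOrbit (endpoints X))
    (k : closure (endpoints X)) : ¬ IsOpen {k} := by
  intro hk
  obtain ⟨U, hU, hUk⟩ := isOpen_induced_iff.1 hk
  have hkU : (k : X) ∈ U := (Set.ext_iff.1 hUk k).2 rfl
  have hUk' : ∀ e ∈ endpoints X, e ∈ U → e = k := fun e he heU =>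
    congrArg Subtype.val ((Set.ext_iff.1 hUk ⟨e, subset_closure he⟩).1 heU)
  have hkE : (k : X) ∈ endpoints X := by
    obtain ⟨e, heU, he⟩ := mem_closure_iff.1 k.2 U hU hkU
    exact hUk' e he heU ▸ he
  refine hnlc (hX.locallyConnectedSpace hR hf hcl fun e he => ?_)
  obtain ⟨x, hx⟩ := horbit
  obtain ⟨g, hg⟩ : ∃ g : X ≃ₜ X, g x = k := (Set.ext_iff.1 hx _).1 hkE
  obtain ⟨g', hg'⟩ : ∃ g : X ≃ₜ X, g x = e := (Set.ext_iff.1 hx _).1 he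
  let φ := g'.symm.trans g
  have hφe : φ e = k := by simp [φ, ← hg', hg]
  refine ⟨φ ⁻¹' U, hU.preimage φ.continuous, Subset.antisymm ?_ ?_⟩
  · rintro y ⟨hyU, hy⟩
    obtain ⟨h, rfl⟩ : ∃ h : X ≃ₜ X, h x = y := (Set.ext_iff.1 hx _).1 hy
    have : φ (h x) ∈ endpoints X := (Set.ext_iff.1 hx _).2 ⟨h.trans φ, rfl⟩
    exact φ.injective ((hUk' _ this hyU).trans hφe.symm)
  · rintro _ rfl
    refine ⟨?_, he⟩
    rw [mem_preimage, hφe]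
    exact hkU

end Legs
end FanTheory

/-! ### Brouwer's characterization of the Cantor space -/

namespace FanTheory

section Brouwer

variable {K : Type*} [TopologicalSpace K] [CompactSpace K] [T2Space K]
  [TotallyDisconnectedSpace K]

theorem exists_clopen_seq [SecondCountableTopology K] : ∃ U : ℕ → Set K, (∀ n, IsClopen (U n)) ∧
    ∀ (x : K) (V : Set K), IsOpen V → x ∈ V → ∃ n, x ∈ U n ∧ U n ⊆ V := by
  obtain ⟨s, hs, hsc, hsb⟩ := (isTopologicalBasis_isClopen (X := K)).exists_countable
  by_cases hne : s.Nonempty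
  · obtain ⟨U, rfl⟩ := hsc.exists_eq_range hne
    refine ⟨U, fun n => hs (mem_range_self n), fun x V hV hx => ?_⟩
    obtain ⟨_, ⟨n, rfl⟩, h1, h2⟩ := hsb.exists_subset_of_mem_open hx hV
    exact ⟨n, h1, h2⟩
  · refine ⟨fun _ => ∅, fun _ => isClopen_empty, fun x V hV hx => ?_⟩
    obtain ⟨W, hW, -, -⟩ := hsb.exists_subset_of_mem_open hx hV
    exact absurd ⟨W, hW⟩ hne

theorem exists_clopen_splitting (hK : ∀ x : K, ¬ IsOpen {x}) {U A : Set K} (hU : IsClopen U)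
    (hA : IsClopen A) (hne : A.Nonempty) : ∃ B, IsClopen B ∧ (A ∩ B).Nonempty ∧ (A \ B).Nonempty ∧
      ((A ∩ U).Nonempty → (A \ U).Nonempty → B = U) := by
  by_cases h : (A ∩ U).Nonempty ∧ (A \ U).Nonempty
  · exact ⟨U, hU, h.1, h.2, fun _ _ => rfl⟩
  obtain ⟨x, hx⟩ := hne
  obtain ⟨y, hy, hyx⟩ : ∃ y ∈ A, y ≠ x := by
    by_contra! hall
    refine hK x ?_
    rw [← (Subset.antisymm hall (singleton_subset_iff.2 hx) : A = {x})]
    exact hA.isOpen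
  obtain ⟨B, hB, hxB, hBy⟩ := compact_exists_isClopen_in_isOpen (isOpen_compl_singleton (x := y))
    (show x ∈ ({y}ᶜ : Set K) from hyx.symm)
  exact ⟨B, hB, ⟨x, hx, hxB⟩, ⟨y, hy, fun h => hBy h rfl⟩, fun h1 h2 => absurd ⟨h1, h2⟩ h⟩

/-- Brouwer's characterization of the Cantor space. Nonempty clopen sets are split in two again
and again, at the `n`-th stage along the `n`-th set `U n` of a countable basis of clopen sets
whenever `U n` does split the set at hand; a branch of the resulting binary tree then shrinks to
a point. -/
theorem nonempty_homeomorph_natToBool [SecondCountableTopology K] [Nonempty K]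
    (hK : ∀ x : K, ¬ IsOpen {x}) : Nonempty ((ℕ → Bool) ≃ₜ K) := by
  obtain ⟨U, hU, hbasis⟩ := exists_clopen_seq (K := K)
  choose B hB hAB hAB' hBU using fun (n : ℕ) (A : {A : Set K // IsClopen A ∧ A.Nonempty}) =>
    exists_clopen_splitting hK (hU n) A.2.1 A.2.2
  let next (n : ℕ) (A : {A : Set K // IsClopen A ∧ A.Nonempty}) (b : Bool) :
      {A : Set K // IsClopen A ∧ A.Nonempty} :=
    bif b then ⟨A ∩ B n A, A.2.1.inter (hB n A), hAB n A⟩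
    else ⟨A \ B n A, A.2.1.diff (hB n A), hAB' n A⟩
  let S (σ : ℕ → Bool) (n : ℕ) : {A : Set K // IsClopen A ∧ A.Nonempty} :=
    Nat.rec ⟨univ, isClopen_univ, univ_nonempty⟩ (fun n A => next n A (σ n)) n
  have hS : ∀ σ n, S σ (n + 1) = next n (S σ n) (σ n) := fun _ _ => rfl
  have hmem : ∀ σ n x, x ∈ (S σ (n + 1)).1 ↔
      x ∈ (S σ n).1 ∧ (x ∈ B n (S σ n) ↔ σ n = true) := by
    intro σ n x
    rw [hS]
    cases σ n <;> simp [next]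
  have hcongr : ∀ σ τ n, (∀ m < n, σ m = τ m) → S σ n = S τ n := by
    intro σ τ n
    induction n with
    | zero => exact fun _ => rfl
    | succ n ih =>
      intro h
      rw [hS, hS, ih fun m hm => h m (hm.trans n.lt_succ_self), h n n.lt_succ_self]
  have hne : ∀ σ, (⋂ n, (S σ n).1).Nonempty := fun σ =>
    IsCompact.nonempty_iInter_of_sequence_nonempty_isCompact_isClosed _
      (fun n x hx => ((hmem σ n x).1 hx).1) (fun n => (S σ n).2.2)
      (S σ 0).2.1.isClosed.isCompact fun n => (S σ n).2.1.isClosed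
  choose g hg using hne
  have hg' : ∀ σ n, g σ ∈ (S σ n).1 := fun σ n => mem_iInter.1 (hg σ) n
  have hsub : ∀ σ n, g σ ∈ U n → (S σ (n + 1)).1 ⊆ U n := by
    intro σ n hgU x hx
    by_contra hxU
    have hBn := hBU n (S σ n) ⟨g σ, hg' σ n, hgU⟩ ⟨x, ((hmem σ n x).1 hx).1, hxU⟩
    have h1 := ((hmem σ n x).1 hx).2
    have h2 := ((hmem σ n _).1 (hg' σ (n + 1))).2
    rw [hBn] at h1 h2
    exact hxU (h1.2 (h2.1 hgU))
  have hinj : Function.Injective g := by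
    intro σ τ h
    funext n
    induction n using Nat.strong_induction_on with
    | _ n ih =>
      have h1 := ((hmem σ n _).1 (hg' σ (n + 1))).2
      have h2 := ((hmem τ n _).1 (hg' τ (n + 1))).2
      rw [hcongr σ τ n ih, h] at h1
      rw [Bool.eq_iff_iff, ← h1, ← h2]
  have hcont : Continuous g := by
    refine continuous_iff_continuousAt.2 fun σ V hV => ?_
    obtain ⟨W, hWV, hW, hgW⟩ := mem_nhds_iff.1 hV
    obtain ⟨n, hn, hnW⟩ := hbasis _ W hW hgW
    have hev : ∀ᶠ τ in 𝓝 σ, ∀ m ∈ Finset.range (n + 1), τ m = σ m := by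
      refine (Finset.eventually_all _).2 fun m _ => ?_
      exact (continuous_apply m).continuousAt ((isOpen_discrete {σ m}).mem_nhds rfl)
    refine hev.mono fun τ hτ => ?_
    refine hWV (hnW (hsub σ n hn ?_))
    rw [hcongr σ τ (n + 1) fun m hm => (hτ m (Finset.mem_range.2 hm)).symm]
    exact hg' τ (n + 1)
  have hsurj : Function.Surjective g := by
    classical
    intro x
    let T (n : ℕ) : {A : Set K // IsClopen A ∧ A.Nonempty} :=
      Nat.rec ⟨univ, isClopen_univ, univ_nonempty⟩ (fun n A => next n A (decide (x ∈ B n A))) n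
    let σ (n : ℕ) : Bool := decide (x ∈ B n (T n))
    have hT : ∀ n, S σ n = T n := by
      intro n
      induction n with
      | zero => rfl
      | succ n ih => rw [hS, ih]
    have hx : ∀ n, x ∈ (S σ n).1 := by
      intro n
      induction n with
      | zero => exact mem_univ x
      | succ n ih =>
        rw [hmem]
        refine ⟨ih, ?_⟩
        rw [hT]
        simp [σ]
    refine ⟨σ, ?_⟩
    by_contra hne
    obtain ⟨n, hn, hnx⟩ := hbasis (g σ) {x}ᶜ isOpen_compl_singleton hne
    exact hnx (hsub σ n hn (hx (n + 1))) rfl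
  exact ⟨hcont.homeoOfEquivCompactToT2 (f := Equiv.ofBijective g ⟨hinj, hsurj⟩)⟩

/-- The Cantor space is homogeneous, being a topological group under pointwise `xor`. -/
theorem exists_homeomorph_natToBool_apply_eq (σ τ : ℕ → Bool) :
    ∃ h : (ℕ → Bool) ≃ₜ (ℕ → Bool), h σ = τ := by
  refine ⟨Homeomorph.piCongrRight fun n => (Equiv.toHomeomorphOfDiscrete
    ⟨fun b => xor b (xor (σ n) (τ n)), fun b => xor b (xor (σ n) (τ n)), ?_, ?_⟩), ?_⟩
  · intro b
    simp
  · intro b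
    simp
  · funext n
    change xor (σ n) (xor (σ n) (τ n)) = τ n
    simp

end Brouwer
end FanTheory

/-! ### Parametrized fans: the Cantor fan and the shrinking Cantor fan -/

namespace FanTheory

section Param

variable {K L X Y : Type*} [TopologicalSpace K] [TopologicalSpace L] [TopologicalSpace X]
  [TopologicalSpace Y] {Z : Set K} {v : X} {Φ : K × unitInterval → X}

theorem IsFanParam.eq_iff (h : IsFanParam Z v Φ) (a b : K × unitInterval) :
    Φ a = Φ b ↔ a = b ∨ ((a.2 = 1 ∨ a.1 ∈ Z) ∧ (b.2 = 1 ∨ b.1 ∈ Z)) := by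
  rw [← h.eq_top_iff, ← h.eq_top_iff]
  constructor
  · intro hab
    by_cases hv : Φ a = v
    · exact Or.inr ⟨hv, hab ▸ hv⟩
    · exact Or.inl (h.eq_of_eq a b hab hv)
  · rintro (rfl | ⟨h1, h2⟩)
    exacts [rfl, h1.trans h2.symm]

theorem IsFanParam.isQuotientMap [CompactSpace K] [T2Space X] (h : IsFanParam Z v Φ) :
    IsQuotientMap Φ := h.continuous.isClosedMap.isQuotientMap h.continuous h.surjective

theorem IsFanParam.comp_homeomorph {W : Set L} {w : Y} {Ψ : L × unitInterval → Y}
    (hΨ : IsFanParam W w Ψ) (h : K ≃ₜ L) :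
    IsFanParam (h ⁻¹' W) w (fun a => Ψ (h a.1, a.2)) where
  continuous := hΨ.continuous.comp (by fun_prop)
  surjective y := by
    obtain ⟨⟨l, u⟩, rfl⟩ := hΨ.surjective y
    exact ⟨(h.symm l, u), by simp⟩
  eq_top_iff k u := hΨ.eq_top_iff (h k) u
  eq_of_eq a b hab ha := by
    have := Prod.ext_iff.1 (hΨ.eq_of_eq _ _ hab ha)
    exact Prod.ext (h.injective this.1) this.2

theorem IsFanParam.homeomorph_comp (hΦ : IsFanParam Z v Φ) (g : X ≃ₜ Y) :
    IsFanParam Z (g v) (g ∘ Φ) where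
  continuous := g.continuous.comp hΦ.continuous
  surjective := g.surjective.comp hΦ.surjective
  eq_top_iff k u := by simp [hΦ.eq_top_iff]
  eq_of_eq a b hab ha := hΦ.eq_of_eq a b (g.injective hab) fun h => ha (congrArg g h)

/-- The pair `(K, Z)` determines the compact Hausdorff space parametrized by it. -/
theorem IsFanParam.nonempty_homeomorph [CompactSpace K] [CompactSpace L] [T2Space X] [T2Space Y]
    {W : Set L} {w : Y} {Ψ : L × unitInterval → Y} (hΦ : IsFanParam Z v Φ)
    (hΨ : IsFanParam W w Ψ) (h : K ≃ₜ L) (hZ : h ⁻¹' W = Z) : Nonempty (X ≃ₜ Y) := by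
  have hΨ' := hΨ.comp_homeomorph h
  rw [hZ] at hΨ'
  let φ : C(K × unitInterval, X) := ⟨Φ, hΦ.continuous⟩
  let ψ : C(K × unitInterval, Y) := ⟨fun a => Ψ (h a.1, a.2), hΨ'.continuous⟩
  have hker : Setoid.ker φ = Setoid.ker ψ := by
    ext a b
    exact (hΦ.eq_iff a b).trans (hΨ'.eq_iff a b).symm
  have e1 := IsQuotientMap.homeomorph (f := φ) hΦ.isQuotientMap
  have e2 := IsQuotientMap.homeomorph (f := ψ) hΨ'.isQuotientMap
  rw [hker] at e1
  exact ⟨e1.symm.trans e2⟩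

end Param

namespace CantorFan

theorem mk_eq_mk {c d : cantorSet} {s u : unitInterval} :
    mk c s = mk d u ↔ (c = d ∧ s = u) ∨ (s = 1 ∧ u = 1) := by
  rw [← Prod.mk_inj]
  exact Quotient.eq (r := cantorFanSetoid)

/-- The top of the Cantor fan. -/
def top : CantorFan := mk ⟨0, zero_mem_cantorSet⟩ 1

theorem mk_eq_top {c : cantorSet} {s : unitInterval} : mk c s = top ↔ s = 1 := by
  unfold top
  rw [mk_eq_mk]
  constructor
  · rintro (⟨-, h⟩ | ⟨h, -⟩) <;> exact h
  · exact fun h => Or.inr ⟨h, rfl⟩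

theorem continuous_mk : Continuous fun a : cantorSet × unitInterval => mk a.1 a.2 :=
  continuous_quotient_mk'

/-- The embedding of the Cantor fan in the plane as a cone. -/
def toPlane : CantorFan → ℝ × ℝ :=
  Quotient.lift (fun a : cantorSet × unitInterval => ((1 - (a.2 : ℝ)) * (a.1 : ℝ), (a.2 : ℝ))) <| by
    rintro a b (rfl | ⟨h, h'⟩)
    · rfl
    · simp [h, h']

instance : T2Space CantorFan := by
  refine T2Space.of_injective_continuous (f := toPlane) ?_
    (Continuous.quotient_lift (by fun_prop) _)
  rintro ⟨c, s⟩ ⟨d, u⟩ h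
  obtain ⟨h1, h2⟩ := Prod.ext_iff.1 h
  change (1 - (s : ℝ)) * (c : ℝ) = (1 - (u : ℝ)) * (d : ℝ) at h1
  obtain rfl : s = u := Subtype.ext h2
  refine mk_eq_mk.2 ?_
  by_cases hs : s = 1
  · exact Or.inr ⟨hs, hs⟩
  · refine Or.inl ⟨Subtype.ext (mul_left_cancel₀ ?_ h1), rfl⟩
    exact sub_ne_zero.2 fun h => hs (Subtype.ext h.symm)

theorem isFanParam : IsFanParam (∅ : Set cantorSet) top fun a => mk a.1 a.2 where
  continuous := continuous_mk
  surjective := by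
    rintro ⟨c, s⟩
    exact ⟨(c, s), rfl⟩
  eq_top_iff c s := by simp [mk_eq_top]
  eq_of_eq a b hab ha := by
    rcases mk_eq_mk.1 hab with ⟨h1, h2⟩ | ⟨h, -⟩
    · exact Prod.ext h1 h2
    · exact absurd (mk_eq_top.2 h) ha

end CantorFan

section Shrinking

/-- The Cantor set has no points in the gap to the right of the `i`-th piece. -/
theorem le_of_mem_cantorSet_of_lt (i : ℕ) : ∀ c ∈ cantorSet, 1 - (1 / 3 : ℝ) ^ i ≤ c →
    c < 1 - (1 / 3) ^ (i + 1) → c ≤ 1 - 2 * (1 / 3) ^ (i + 1) := by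
  induction i with
  | zero =>
    intro c hc _ h
    rw [cantorSet_eq_union_halves] at hc
    norm_num at h ⊢
    rcases hc with ⟨x, hx, rfl⟩ | ⟨x, hx, rfl⟩
    · have := (cantorSet_subset_unitInterval hx).2
      simp only
      linarith
    · have := (cantorSet_subset_unitInterval hx).1
      simp only at h
      linarith
  | succ i ih =>
    intro c hc h0 h
    have hp : (0 : ℝ) < (1 / 3) ^ i := by positivity
    have hp1 : (1 / 3 : ℝ) ^ i ≤ 1 := pow_le_one₀ (by norm_num) (by norm_num)
    rw [cantorSet_eq_union_halves] at hc
    simp only [pow_succ] at h0 h ih ⊢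
    rcases hc with ⟨x, hx, rfl⟩ | ⟨x, hx, rfl⟩
    · have := (cantorSet_subset_unitInterval hx).2
      simp only at h0
      linarith
    · have := ih x hx (by simp only at h0; linarith) (by simp only at h; linarith)
      simp only
      linarith

theorem exists_piece {c : ℝ} (hc : c ∈ cantorSet) (hc1 : c ≠ 1) :
    ∃ i : ℕ, 1 - (1 / 3 : ℝ) ^ i ≤ c ∧ c ≤ 1 - 2 * (1 / 3) ^ (i + 1) := by
  have h01 := cantorSet_subset_unitInterval hc
  have hex : ∃ i : ℕ, c < 1 - (1 / 3 : ℝ) ^ (i + 1) := by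
    obtain ⟨n, hn⟩ := exists_pow_lt_of_lt_one (sub_pos.2 (lt_of_le_of_ne h01.2 hc1))
      (by norm_num : (1 / 3 : ℝ) < 1)
    have : (1 / 3 : ℝ) ^ (n + 1) ≤ (1 / 3) ^ n :=
      pow_le_pow_of_le_one (by norm_num) (by norm_num) n.le_succ
    exact ⟨n, by linarith⟩
  classical
  have h1 := Nat.find_spec hex
  have h0 : 1 - (1 / 3 : ℝ) ^ Nat.find hex ≤ c := by
    rcases Nat.eq_zero_or_pos (Nat.find hex) with h | h
    · rw [h]
      simpa using h01.1
    · obtain ⟨m, hm⟩ := Nat.exists_eq_succ_of_ne_zero h.ne'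
      rw [hm]
      exact not_lt.1 (Nat.find_min hex (m := m) (by omega))
  exact ⟨_, h0, le_of_mem_cantorSet_of_lt _ c hc h0 h1⟩

/-- A continuous function with value `1 / 2 ^ i` on the `i`-th piece of the Cantor set and value `0`
at `1`: each summand passes from `0` to `1` across the gap to the right of the `i`-th piece. -/
noncomputable def legLength (c : ℝ) : ℝ :=
  1 - ∑' i : ℕ, 1 / 2 / 2 ^ i * max 0 (min 1 (3 ^ (i + 1) * (c - 1) + 2))

theorem continuous_legLength : Continuous legLength := by
  refine continuous_const.sub (continuous_tsum (u := fun i : ℕ => (1 : ℝ) / 2 / 2 ^ i)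
    (fun i => by fun_prop) (summable_geometric_two' 1) fun i c => ?_)
  have h0 : (0 : ℝ) ≤ max 0 (min 1 (3 ^ (i + 1) * (c - 1) + 2)) := le_max_left _ _
  have h1 : max 0 (min 1 ((3 : ℝ) ^ (i + 1) * (c - 1) + 2)) ≤ 1 :=
    max_le zero_le_one (min_le_left _ _)
  rw [Real.norm_of_nonneg (by positivity)]
  exact mul_le_of_le_one_right (by positivity) h1

theorem legLength_one : legLength 1 = 0 := by
  have : ∀ i : ℕ, 1 / 2 / 2 ^ i * max 0 (min 1 ((3 : ℝ) ^ (i + 1) * (1 - 1) + 2)) =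
      1 / 2 / 2 ^ i := by
    intro i
    norm_num
  unfold legLength
  simp only [this]
  rw [tsum_geometric_two', sub_self]

theorem legLength_eq {c : ℝ} {j : ℕ} (h0 : 1 - (1 / 3 : ℝ) ^ j ≤ c)
    (h1 : c ≤ 1 - 2 * (1 / 3) ^ (j + 1)) : legLength c = 1 / 2 ^ j := by
  have hpow : ∀ m n : ℕ, m ≤ n → (1 / 3 : ℝ) ^ n ≤ (1 / 3) ^ m := fun m n h =>
    pow_le_pow_of_le_one (by norm_num) (by norm_num) h
  have hcancel : ∀ m : ℕ, (3 : ℝ) ^ m * (1 / 3) ^ m = 1 := fun m => by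
    rw [← mul_pow]; norm_num
  have hout : ∀ i ∉ Finset.range j,
      1 / 2 / 2 ^ i * max 0 (min 1 ((3 : ℝ) ^ (i + 1) * (c - 1) + 2)) = 0 := by
    intro i hi
    have hij : j ≤ i := not_lt.1 fun h => hi (Finset.mem_range.2 h)
    have h2 : (3 : ℝ) ^ (i + 1) * (c - 1) ≤ 3 ^ (i + 1) * (-2 * (1 / 3) ^ (i + 1)) :=
      mul_le_mul_of_nonneg_left (by linarith [hpow (j + 1) (i + 1) (by omega)]) (by positivity)
    have h3 : (3 : ℝ) ^ (i + 1) * (-2 * (1 / 3) ^ (i + 1)) = -2 := by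
      linear_combination (-2) * hcancel (i + 1)
    rw [max_eq_left ((min_le_right _ _).trans (by linarith)), mul_zero]
  have hin : ∀ i ∈ Finset.range j,
      1 / 2 / 2 ^ i * max 0 (min 1 ((3 : ℝ) ^ (i + 1) * (c - 1) + 2)) = 1 / 2 / 2 ^ i := by
    intro i hi
    have hij : i + 1 ≤ j := Finset.mem_range.1 hi
    have h2 : (3 : ℝ) ^ (i + 1) * (-1 * (1 / 3) ^ (i + 1)) ≤ 3 ^ (i + 1) * (c - 1) :=
      mul_le_mul_of_nonneg_left (by linarith [hpow (i + 1) j hij]) (by positivity)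
    have h3 : (3 : ℝ) ^ (i + 1) * (-1 * (1 / 3) ^ (i + 1)) = -1 := by
      linear_combination (-1) * hcancel (i + 1)
    rw [min_eq_left (by linarith), max_eq_right zero_le_one, mul_one]
  have hsum : ∀ n : ℕ, ∑ i ∈ Finset.range n, (1 : ℝ) / 2 / 2 ^ i = 1 - 1 / 2 ^ n := by
    intro n
    induction n with
    | zero => simp
    | succ n ih =>
      rw [Finset.sum_range_succ, ih, pow_succ]
      field_simp
      ring
  unfold legLength
  rw [tsum_eq_sum hout, Finset.sum_congr rfl hin, hsum]
  ring

/-- Membership in a piece, with the bounds in the form of distances from `1`. -/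
theorem mem_shrinkingPiece {i : ℕ} {x : CantorFan} : x ∈ shrinkingPiece i ↔
    ∃ (c : cantorSet) (s : unitInterval), (1 - (1 / 3 : ℝ) ^ i ≤ c ∧
      (c : ℝ) ≤ 1 - 2 * (1 / 3) ^ (i + 1)) ∧ 1 - 1 / (2 : ℝ) ^ i ≤ (s : ℝ) ∧
      x = CantorFan.mk c s := by
  have h1 : ((3 : ℝ) ^ i - 1) / 3 ^ i = 1 - (1 / 3) ^ i := by
    rw [one_div_pow]
    field_simp
  have h2 : ((3 : ℝ) ^ (i + 1) - 2) / 3 ^ (i + 1) = 1 - 2 * (1 / 3) ^ (i + 1) := by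
    rw [one_div_pow]
    field_simp
  unfold shrinkingPiece
  rw [h1, h2]
  rfl

theorem legLength_mem (c : cantorSet) : legLength c ∈ Icc (0 : ℝ) 1 := by
  by_cases hc : (c : ℝ) = 1
  · rw [hc, legLength_one]
    simp
  · obtain ⟨i, h0, h1⟩ := exists_piece c.2 hc
    rw [legLength_eq h0 h1]
    exact ⟨by positivity, (div_le_one (by positivity)).2 (one_le_pow₀ (by norm_num))⟩

theorem legLength_eq_zero_iff (c : cantorSet) : legLength c = 0 ↔ (c : ℝ) = 1 := by
  constructor
  · intro h
    by_contra hc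
    obtain ⟨i, h0, h1⟩ := exists_piece c.2 hc
    rw [legLength_eq h0 h1] at h
    have : (0 : ℝ) < 1 / 2 ^ i := by positivity
    exact this.ne' h
  · intro h
    rw [h, legLength_one]

/-- The second coordinate of the point at parameter `u` on the leg of `c` in the shrinking Cantor
fan. The parameter runs from `0` at the end of the leg to `1` at the top. -/
noncomputable def legHeight (c : cantorSet) (u : unitInterval) : unitInterval :=
  ⟨1 - (1 - (u : ℝ)) * legLength c, by
    have h := legLength_mem c
    have h0 := u.2.1
    have h1 := u.2.2
    constructor
    · have := mul_le_one₀ (by linarith : 1 - (u : ℝ) ≤ 1) h.1 h.2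
      linarith
    · have := mul_nonneg (by linarith : 0 ≤ 1 - (u : ℝ)) h.1
      linarith⟩

theorem continuous_legHeight :
    Continuous fun a : cantorSet × unitInterval => legHeight a.1 a.2 := by
  have := continuous_legLength
  unfold legHeight
  fun_prop

theorem legHeight_eq_one_iff {c : cantorSet} {u : unitInterval} :
    legHeight c u = 1 ↔ u = 1 ∨ (c : ℝ) = 1 := by
  rw [← legLength_eq_zero_iff, Subtype.ext_iff, Subtype.ext_iff (a1 := u)]
  simp only [legHeight, Set.Icc.coe_one, sub_eq_self, mul_eq_zero, sub_eq_zero]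
  rw [eq_comm (a := (1 : ℝ))]

theorem mk_legHeight_mem (c : cantorSet) (u : unitInterval) :
    CantorFan.mk c (legHeight c u) ∈ shrinkingCantorFan := by
  by_cases hc : (c : ℝ) = 1
  -- the leg at `1` is degenerate, and its only point, the top, is found in the first piece
  · refine mem_iUnion.2 ⟨0, mem_shrinkingPiece.2 ⟨⟨0, zero_mem_cantorSet⟩, 1, ?_, ?_, ?_⟩⟩
    · norm_num
    · norm_num
    · exact CantorFan.mk_eq_mk.2 (Or.inr ⟨legHeight_eq_one_iff.2 (Or.inr hc), rfl⟩)
  · obtain ⟨i, h0, h1⟩ := exists_piece c.2 hc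
    refine mem_iUnion.2 ⟨i, mem_shrinkingPiece.2 ⟨c, _, ⟨h0, h1⟩, ?_, rfl⟩⟩
    have : (0 : ℝ) ≤ u * (1 / 2 ^ i) := mul_nonneg u.2.1 (by positivity)
    simp only [legHeight, legLength_eq h0 h1]
    linarith

/-- The top of the shrinking Cantor fan. -/
noncomputable def shrinkingTop : shrinkingCantorFan :=
  ⟨_, mk_legHeight_mem ⟨0, zero_mem_cantorSet⟩ 1⟩

theorem isFanParam_shrinkingCantorFan :
    IsFanParam {c : cantorSet | (c : ℝ) = 1} shrinkingTop
      fun a => (⟨_, mk_legHeight_mem a.1 a.2⟩ : shrinkingCantorFan) := by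
  have htop : (shrinkingTop : CantorFan) = CantorFan.top :=
    CantorFan.mk_eq_top.2 (legHeight_eq_one_iff.2 (Or.inl rfl))
  have htop_iff : ∀ c u, (⟨_, mk_legHeight_mem c u⟩ : shrinkingCantorFan) = shrinkingTop ↔
      u = 1 ∨ (c : ℝ) = 1 := by
    intro c u
    rw [Subtype.ext_iff, htop, CantorFan.mk_eq_top, legHeight_eq_one_iff]
  refine ⟨?_, ?_, htop_iff, ?_⟩
  · exact (CantorFan.continuous_mk.comp
      (continuous_fst.prodMk continuous_legHeight)).subtype_mk _
  · rintro ⟨x, hx⟩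
    obtain ⟨i, hi⟩ := mem_iUnion.1 hx
    obtain ⟨c, s, ⟨h0, h1⟩, hs, rfl⟩ := mem_shrinkingPiece.1 hi
    have hpos : (0 : ℝ) < 2 ^ i := by positivity
    have hs1 : (s : ℝ) ≤ 1 := s.2.2
    have hle : (1 - (s : ℝ)) * 2 ^ i ≤ 1 := by
      rw [← le_div_iff₀ hpos]
      linarith
    have hge : 0 ≤ (1 - (s : ℝ)) * 2 ^ i := mul_nonneg (by linarith) hpos.le
    refine ⟨(c, ⟨1 - (1 - s) * 2 ^ i, by linarith, by linarith⟩), Subtype.ext ?_⟩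
    refine CantorFan.mk_eq_mk.2 (Or.inl ⟨rfl, Subtype.ext ?_⟩)
    simp only [legHeight, legLength_eq h0 h1]
    field_simp
    ring
  · rintro ⟨c, u⟩ ⟨d, w⟩ h hne
    have hcu := mt (htop_iff c u).2 hne
    rw [not_or] at hcu
    rcases CantorFan.mk_eq_mk.1 (Subtype.ext_iff.1 h) with ⟨h1, h2⟩ | ⟨h1, -⟩
    · obtain rfl : c = d := h1
      have h3 := Subtype.ext_iff.1 h2
      simp only [legHeight, sub_right_inj] at h3
      have h4 := mul_right_cancel₀ (mt (legLength_eq_zero_iff c).1 hcu.2) h3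
      exact Prod.ext rfl (Subtype.ext (by simpa using h4))
    · exact absurd (legHeight_eq_one_iff.1 h1) (not_or.2 hcu)

end Shrinking
end FanTheory

/-! ### Endpoints of parametrized fans, and the closure of the set of endpoints -/

namespace FanTheory

section ParamFan

variable {K X : Type*} [TopologicalSpace K] [TopologicalSpace X] {Z : Set K} {v t : X}
  {Φ : K × unitInterval → X}

theorem IsFanParam.continuous_leg (h : IsFanParam Z v Φ) (k : K) :
    Continuous fun s => Φ (k, s) := h.continuous.comp (by fun_prop)

theorem IsFanParam.injective_leg (h : IsFanParam Z v Φ) {k : K} (hk : k ∉ Z) :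
    Function.Injective fun s => Φ (k, s) := by
  intro s u hsu
  rcases (h.eq_iff _ _).1 hsu with h' | ⟨h1, h2⟩
  · exact (Prod.ext_iff.1 h').2
  · exact (h1.resolve_right hk).trans (h2.resolve_right hk).symm

variable [T2Space X]

/-- Three nondegenerate legs make the common point of the legs the top. -/
theorem IsFanParam.eq_top (h : IsFanParam Z v Φ) (hX : IsFan X t) {a b c : K} (ha : a ∉ Z)
    (hb : b ∉ Z) (hc : c ∉ Z) (hab : a ≠ b) (hac : a ≠ c) (hbc : b ≠ c) : v = t := by
  have harc : ∀ k ∉ Z, IsArcBetween (range fun s => Φ (k, s)) v (Φ (k, 0)) := fun k hk =>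
    (isArcBetween_iff.2 ⟨_, h.continuous_leg k, h.injective_leg hk, rfl,
      (h.eq_top_iff k 1).2 (Or.inl rfl), rfl⟩ : IsArcBetween _ (Φ (k, 0)) v).symm
  have hinter : ∀ k ∉ Z, ∀ l ∉ Z, k ≠ l →
      (range fun s => Φ (k, s)) ∩ (range fun s => Φ (l, s)) = {v} := by
    intro k hk l hl hkl
    refine Subset.antisymm ?_
      (singleton_subset_iff.2 ⟨(harc k hk).left_mem, (harc l hl).left_mem⟩)
    rintro _ ⟨⟨s, rfl⟩, ⟨u, hu⟩⟩
    by_contra hv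
    exact hkl (Prod.ext_iff.1 (h.eq_of_eq _ _ hu.symm hv)).1
  exact hX.eq_top_of_two_lt_pointOrder (two_lt_pointOrder (harc a ha) (harc b hb) (harc c hc)
    (hinter a ha b hb hab) (hinter a ha c hc hac) (hinter b hb c hc hbc))

theorem IsFanParam.seg_eq (h : IsFanParam Z v Φ) (hX : IsFan X t) {k : K} (hk : k ∉ Z)
    (u : unitInterval) : seg v (Φ (k, u)) = (fun s => Φ (k, s)) '' Icc u 1 := by
  have hu : u ≤ 1 := u.2.2
  have := hX.dendroid.seg_image (h.continuous_leg k) (h.injective_leg hk) hu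
  rw [← this, seg_comm, (h.eq_top_iff k 1).2 (Or.inl rfl)]

/-- The endpoints of a parametrized fan are the ends of its nondegenerate legs. -/
theorem IsFanParam.endpoints_eq (h : IsFanParam Z t Φ) (hX : IsFan X t) :
    endpoints X = (fun k => Φ (k, 0)) '' Zᶜ := by
  ext e
  rw [hX.mem_endpoints_iff]
  constructor
  · rintro ⟨het, hmax⟩
    obtain ⟨⟨k, u⟩, rfl⟩ := h.surjective e
    have hk : k ∉ Z := fun hk => het ((h.eq_top_iff k u).2 (Or.inr hk))
    refine ⟨k, hk, hmax _ ?_⟩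
    rw [h.seg_eq hX hk]
    exact ⟨u, u.2, rfl⟩
  · rintro ⟨k, hk, rfl⟩
    have hkt : Φ (k, 0) ≠ t := by
      rw [Ne, h.eq_top_iff, not_or]
      exact ⟨zero_ne_one, hk⟩
    refine ⟨hkt, fun y hy => ?_⟩
    obtain ⟨⟨l, u⟩, rfl⟩ := h.surjective y
    by_cases hl : l ∈ Z
    · simp only [(h.eq_top_iff l u).2 (Or.inr hl), seg_self] at hy
      exact absurd hy hkt
    · rw [h.seg_eq hX hl] at hy
      obtain ⟨s, hs, hsk⟩ := hy
      obtain ⟨rfl, rfl⟩ := Prod.ext_iff.1 (h.eq_of_eq (k, 0) (l, s) hsk.symm hkt)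
      have : u = 0 := le_antisymm hs.1 u.2.1
      rw [this]

end ParamFan

section CantorSet

theorem three_quarters_mem_cantorSet : (3 / 4 : ℝ) ∈ cantorSet :=
  mem_iInter.2 fun n => (quarters_mem_preCantorSet n).2

theorem one_sub_pow_mem_cantorSet (n : ℕ) : 1 - (1 / 3 : ℝ) ^ n ∈ cantorSet := by
  induction n with
  | zero => simpa using zero_mem_cantorSet
  | succ n ih =>
    rw [cantorSet_eq_union_halves]
    refine Or.inr ⟨_, ih, ?_⟩
    simp only [pow_succ]
    ring

theorem one_mem_cantorSet : (1 : ℝ) ∈ cantorSet := by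
  refine isClosed_cantorSet.mem_of_tendsto (b := atTop) ?_
    (Eventually.of_forall one_sub_pow_mem_cantorSet)
  simpa using (tendsto_pow_atTop_nhds_zero_of_lt_one (by norm_num : (0 : ℝ) ≤ 1 / 3)
    (by norm_num)).const_sub 1

end CantorSet

section EndpointsOfParam

variable {X : Type*} [TopologicalSpace X] [T2Space X] {t : X}

/-- A parametrization of a fan over the Cantor set has the top of the fan as its common point,
if at most the leg at `1` is degenerate. -/
theorem IsFanParam.eq_top_of_cantorSet {v : X} {Φ : cantorSet × unitInterval → X}
    {Z : Set cantorSet} (h : IsFanParam Z v Φ) (hX : IsFan X t) (hZ : ∀ c ∈ Z, (c : ℝ) = 1) :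
    v = t := by
  refine h.eq_top hX (a := ⟨0, zero_mem_cantorSet⟩) (b := ⟨1 / 4, quarter_mem_cantorSet⟩)
    (c := ⟨3 / 4, three_quarters_mem_cantorSet⟩) (fun h => ?_) (fun h => ?_) (fun h => ?_) ?_ ?_ ?_
  · have := hZ _ h
    norm_num at this
  · have := hZ _ h
    norm_num at this
  · have := hZ _ h
    norm_num at this
  · rw [Ne, Subtype.mk.injEq]
    norm_num
  · rw [Ne, Subtype.mk.injEq]
    norm_num
  · rw [Ne, Subtype.mk.injEq]
    norm_num

theorem IsFan.isClosed_endpoints_of_homeomorph (hX : IsFan X t) (g : X ≃ₜ CantorFan) :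
    IsClosed (endpoints X) := by
  have h := CantorFan.isFanParam.homeomorph_comp g.symm
  have htop := h.eq_top_of_cantorSet hX (by simp)
  rw [htop] at h
  have : CompactSpace cantorSet := isCompact_iff_compactSpace.1 isCompact_cantorSet
  rw [h.endpoints_eq hX, compl_empty, image_univ]
  exact (isCompact_range (h.continuous.comp (by fun_prop))).isClosed

theorem IsFan.closure_endpoints_of_homeomorph (hX : IsFan X t) (g : X ≃ₜ shrinkingCantorFan) :
    closure (endpoints X) = endpoints X ∪ {t} := by
  have h := isFanParam_shrinkingCantorFan.homeomorph_comp g.symm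
  have htop := h.eq_top_of_cantorSet hX (fun c hc => hc)
  rw [htop] at h
  have : CompactSpace cantorSet := isCompact_iff_compactSpace.1 isCompact_cantorSet
  generalize hΦ : (g.symm ∘ fun a : cantorSet × unitInterval =>
    (⟨_, mk_legHeight_mem a.1 a.2⟩ : shrinkingCantorFan)) = Φ at h
  have hend : Continuous fun k => Φ (k, 0) := h.continuous.comp (by fun_prop)
  have h1 : Φ (⟨1, one_mem_cantorSet⟩, 0) = t := (h.eq_top_iff _ _).2 (Or.inr rfl)
  rw [h.endpoints_eq hX]
  refine Subset.antisymm (closure_minimal ?_ ?_) (union_subset subset_closure ?_)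
  · exact subset_union_left
  · have : (fun k => Φ (k, 0)) '' {c : cantorSet | (c : ℝ) = 1}ᶜ ∪ {t} =
        range fun k => Φ (k, 0) := by
      rw [← image_univ, ← compl_union_self {c : cantorSet | (c : ℝ) = 1}, image_union]
      congr 1
      ext x
      constructor
      · rintro rfl
        exact ⟨_, rfl, h1⟩
      · rintro ⟨c, hc, rfl⟩
        exact (h.eq_top_iff _ _).2 (Or.inr hc)
    rw [this]
    exact (isCompact_range hend).isClosed
  · rw [singleton_subset_iff, ← h1]
    have hlim : Tendsto (fun n : ℕ => (⟨_, one_sub_pow_mem_cantorSet n⟩ : cantorSet)) atTop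
        (𝓝 ⟨1, one_mem_cantorSet⟩) := by
      rw [tendsto_subtype_rng]
      simpa using (tendsto_pow_atTop_nhds_zero_of_lt_one (by norm_num : (0 : ℝ) ≤ 1 / 3)
        (by norm_num)).const_sub 1
    refine mem_closure_of_tendsto ((hend.tendsto _).comp hlim)
      (Eventually.of_forall fun n => ⟨_, ?_, rfl⟩)
    simp

end EndpointsOfParam

/-- If the endpoints form an orbit and accumulate at most at the top, and the fan is not locally
connected, then the closure of the set of endpoints is a Cantor set; the
homeomorphism with the Cantor set can be prescribed at one point. -/
theorem IsFan.exists_closure_endpoints_homeomorph {X : Type*} [MetricSpace X] {t : X}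
    (hX : IsFan X t) (hs : IsSmooth X) (hnlc : ¬ LocallyConnectedSpace X)
    (horbit : IsHomeoOrbit (endpoints X)) (hcl : closure (endpoints X) ⊆ endpoints X ∪ {t})
    (k : closure (endpoints X)) (c : cantorSet) :
    ∃ h : closure (endpoints X) ≃ₜ cantorSet, h k = c := by
  have := hX.dendroid.compact
  have hR := hX.isClosed_segGraph_top hs
  obtain ⟨f, hf⟩ := hX.dendroid.exists_isHeight hR
  have : CompactSpace (closure (endpoints X)) :=
    isCompact_iff_compactSpace.1 isClosed_closure.isCompact
  have : TotallyDisconnectedSpace (closure (endpoints X)) :=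
    totallyDisconnectedSpace_subtype_iff.2 (hX.isTotallyDisconnected_closure_endpoints hcl)
  have : Nonempty (closure (endpoints X)) := ⟨k⟩
  obtain ⟨g⟩ := nonempty_homeomorph_natToBool
    (hX.not_isOpen_singleton hR hf hcl hnlc horbit)
  obtain ⟨φ, hφ⟩ := exists_homeomorph_natToBool_apply_eq (g.symm k)
    (cantorSetHomeomorphNatToBool c)
  exact ⟨(g.symm.trans φ).trans cantorSetHomeomorphNatToBool.symm, by simp [hφ]⟩

/-- A smooth fan whose endpoints accumulate at most at the top is homeomorphic to any compact
Hausdorff space parametrized over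
the Cantor set, if the degenerate legs correspond to each other. -/
theorem IsFan.nonempty_homeomorph_of_isFanParam {X Y : Type*} [MetricSpace X] [TopologicalSpace Y]
    [T2Space Y] {t : X} (hX : IsFan X t) (hs : IsSmooth X) (hne : (endpoints X).Nonempty)
    (hcl : closure (endpoints X) ⊆ endpoints X ∪ {t}) {Z : Set cantorSet} {w : Y}
    {Ψ : cantorSet × unitInterval → Y} (hΨ : IsFanParam Z w Ψ)
    (h : closure (endpoints X) ≃ₜ cantorSet) (hZ : ∀ k, h k ∈ Z ↔ (k : X) = t) :
    Nonempty (X ≃ₜ Y) := by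
  have := hX.dendroid.compact
  have hR := hX.isClosed_segGraph_top hs
  obtain ⟨f, hf⟩ := hX.dendroid.exists_isHeight hR
  have : CompactSpace (closure (endpoints X)) :=
    isCompact_iff_compactSpace.1 isClosed_closure.isCompact
  have : CompactSpace cantorSet := isCompact_iff_compactSpace.1 isCompact_cantorSet
  obtain ⟨Φ, hΦ⟩ := hX.exists_isFanParam hR hf hne hcl
  exact hΦ.nonempty_homeomorph hΨ h (Set.ext hZ)

end FanTheory

theorem theorem2p2 {X : Type*} [MetricSpace X] (t : X)
    (hfan : FanTheory.IsFan X t) (hsmooth : FanTheory.IsSmooth X)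
    (hnlc : ¬ LocallyConnectedSpace X)
    (horbit : FanTheory.IsHomeoOrbit (FanTheory.endpoints X)) :
    (Nonempty (X ≃ₜ FanTheory.CantorFan) ↔ IsClosed (FanTheory.endpoints X)) ∧
    (Nonempty (X ≃ₜ FanTheory.shrinkingCantorFan) ↔
      closure (FanTheory.endpoints X) = FanTheory.endpoints X ∪ {t}) := by
  have hte : ∀ e ∈ FanTheory.endpoints X, e ≠ t := fun e he => (hfan.mem_endpoints_iff.1 he).1
  obtain ⟨e, he⟩ : (FanTheory.endpoints X).Nonempty := by
    obtain ⟨x, hx⟩ := horbit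
    exact ⟨x, hx ▸ ⟨Homeomorph.refl X, rfl⟩⟩
  refine ⟨⟨?_, fun hcl => ?_⟩, ⟨?_, fun hcl => ?_⟩⟩
  · rintro ⟨g⟩
    exact hfan.isClosed_endpoints_of_homeomorph g
  · have hsub : closure (FanTheory.endpoints X) ⊆ FanTheory.endpoints X ∪ {t} :=
      hcl.closure_eq.subset.trans subset_union_left
    obtain ⟨h, -⟩ := hfan.exists_closure_endpoints_homeomorph hsmooth hnlc horbit hsub
      ⟨e, subset_closure he⟩ ⟨0, zero_mem_cantorSet⟩
    refine hfan.nonempty_homeomorph_of_isFanParam hsmooth ⟨e, he⟩ hsub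
      FanTheory.CantorFan.isFanParam h fun k => ?_
    exact iff_of_false (Set.notMem_empty _) (hte _ (hcl.closure_eq.subset k.2))
  · rintro ⟨g⟩
    exact hfan.closure_endpoints_of_homeomorph g
  · have ht : t ∈ closure (FanTheory.endpoints X) := hcl ▸ Or.inr rfl
    obtain ⟨h, hh⟩ := hfan.exists_closure_endpoints_homeomorph hsmooth hnlc horbit hcl.subset
      ⟨t, ht⟩ ⟨1, FanTheory.one_mem_cantorSet⟩
    refine hfan.nonempty_homeomorph_of_isFanParam hsmooth ⟨e, he⟩ hcl.subset
      FanTheory.isFanParam_shrinkingCantorFan h fun k => ?_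
    rw [Set.mem_ofPred_eq, ← Subtype.ext_iff (a2 := ⟨1, FanTheory.one_mem_cantorSet⟩), ← hh,
      h.injective.eq_iff, Subtype.ext_iff]
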